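/- Let $k,n\ge 0$ be integers and $[n]=\{1,\dots,n\}$. Let $\widetilde{\mathrm{Gr}}(k,n)$ be the affine cone over the real Grassmannian $\mathrm{Gr}(k,n)$ of $k$-planes in $\mathbb{R}^n$: a point $X$ of it is a family of real numbers $\Delta_I(X)$, one for each $k$-element subset $I\subset[n]$, satisfying the Plücker relations. Let $\widetilde{\mathrm{Gr}}(k,n)_{\ge 0}$ be its totally nonnegative part, the set of those $X$ with $\Delta_I(X)\ge 0$ for all $I$. Let $I,J$ be $k$-element subsets of $[n]$. If the multiset union of $I$ and $J$ is sorted as $a_1\le b_1\le a_2\le b_2\le\cdots\le a_k\le b_k$, put $\mathrm{sort}_1(I,J)=\{a_1,\dots,a_k\}$ and $\mathrm{sort}_2(I,J)=\{b_1,\dots,b_k\}$. For disjoint sets $A=\{i_1<\cdots<i_m\}$ and $B=\{j_1<\cdots<j_m\}$ of the same size put $\min(A,B)=\{\min(i_1,j_1),\dots,\min(i_m,j_m)\}$ and $\max(A,B)=\{\max(i_1,j_1),\dots,\max(i_m,j_m)\}$; for general $I,J$ put $\min(I,J)=\min(I\setminus J,J\setminus I)\cup(I\cap J)$ and $\max(I,J)=\max(I\setminus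 J,J\setminus I)\cup(I\cap J)$. Then for every $X\in\widetilde{\mathrm{Gr}}(k,n)_{\ge 0}$ and all $k$-element subsets $I,J\subset[n]$, $$\Delta_I(X)\,\Delta_J(X)\ \le\ \Delta_{\min(I,J)}(X)\,\Delta_{\max(I,J)}(X)\ \le\ \Delta_{\mathrm{sort}_1(I,J)}(X)\,\Delta_{\mathrm{sort}_2(I,J)}(X).$$ -/

import Mathlib

/-- The `k`-element subsets of `[n]`, with `[n]` realised as the linearly ordered set `Fin n`. -/
abbrev KSubset (k n : ℕ) : Type := {I : Finset (Fin n) // I.card = k}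

/-- The increasing enumeration `i₁ < i₂ < ⋯ < iₖ` of the elements of a `k`-element subset. -/
def KSubset.elt {k n : ℕ} (I : KSubset k n) : Fin k → Fin n :=
  I.1.orderEmbOfFin I.2

/-- The underlying subset of a sequence of `k` distinct elements of `[n]`. -/
def KSubset.ofInjective {k n : ℕ} (u : Fin k → Fin n) (hu : Function.Injective u) :
    KSubset k n :=
  ⟨Finset.univ.image u, by rw [Finset.card_image_of_injective _ hu]; simp⟩

noncomputable section

/-- The usual extension of a family `X = (Δ_I)` indexed by `k`-element subsets to an alternating
function of sequences of `k` indices: it is `0` if an index is repeated, and otherwise it is the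
value at the underlying set, multiplied by the sign of the permutation sorting the sequence. -/
def pluckerBracket {k n : ℕ} (X : KSubset k n → ℝ) (u : Fin k → Fin n) : ℝ :=
  if hu : Function.Injective u then
    ((Equiv.Perm.sign (Tuple.sort u) : ℤ) : ℝ) * X (KSubset.ofInjective u hu)
  else 0

/-- The affine cone over the real Grassmannian `Gr(k,n)`: the families `(Δ_I)` that satisfy the
Plücker relations. In the relation, the index in a fixed position `r` of the second sequence
is exchanged with the index in position `s` of the first one, summed over all `s`. -/
def grassmannianCone (k n : ℕ) : Set (KSubset k n → ℝ) :=
  {X | ∀ (u v : Fin k → Fin n) (r : Fin k),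
    pluckerBracket X u * pluckerBracket X v =
      ∑ s : Fin k, pluckerBracket X (Function.update u s (v r)) *
        pluckerBracket X (Function.update v r (u s))}

/-- The totally nonnegative part of the cone over the Grassmannian. -/
def tnnGrassmannianCone (k n : ℕ) : Set (KSubset k n → ℝ) :=
  {X | X ∈ grassmannianCone k n ∧ ∀ I, 0 ≤ X I}

end

/-- For `A = {a₁ < ⋯ < aₘ}` and `B = {b₁ < ⋯ < bₘ}`, the set `{min(a₁,b₁), …, min(aₘ,bₘ)}`. -/
def termwiseMin {m n : ℕ} (A B : KSubset m n) : KSubset m n :=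
  KSubset.ofInjective (fun r => min (A.elt r) (B.elt r)) (by
    have hA : StrictMono A.elt := (A.1.orderEmbOfFin A.2).strictMono
    have hB : StrictMono B.elt := (B.1.orderEmbOfFin B.2).strictMono
    exact StrictMono.injective fun r s h => min_lt_min (hA h) (hB h))

/-- For `A = {a₁ < ⋯ < aₘ}` and `B = {b₁ < ⋯ < bₘ}`, the set `{max(a₁,b₁), …, max(aₘ,bₘ)}`. -/
def termwiseMax {m n : ℕ} (A B : KSubset m n) : KSubset m n :=
  KSubset.ofInjective (fun r => max (A.elt r) (B.elt r)) (by
    have hA : StrictMono A.elt := (A.1.orderEmbOfFin A.2).strictMono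
    have hB : StrictMono B.elt := (B.1.orderEmbOfFin B.2).strictMono
    exact StrictMono.injective fun r s h => max_lt_max (hA h) (hB h))

/-- The difference `I - J`, as a set of size `|I - J|`. -/
def KSubset.diffLeft {k n : ℕ} (I J : KSubset k n) : KSubset (I.1 \ J.1).card n :=
  ⟨I.1 \ J.1, rfl⟩

/-- The difference `J - I`, as a set of size `|I - J|`. -/
def KSubset.diffRight {k n : ℕ} (I J : KSubset k n) : KSubset (I.1 \ J.1).card n :=
  ⟨J.1 \ I.1, Finset.card_sdiff_comm (J.2.trans I.2.symm)⟩

theorem KSubset.card_union_inter {k n : ℕ} (I J : KSubset k n)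
    (C : KSubset (I.1 \ J.1).card n)
    (hC : ∀ x ∈ C.1, x ∈ I.1 \ J.1 ∨ x ∈ J.1 \ I.1) :
    (C.1 ∪ (I.1 ∩ J.1)).card = k := by
  rw [Finset.card_union_of_disjoint, C.2, Finset.card_sdiff_add_card_inter, I.2]
  rw [Finset.disjoint_left]
  intro x hx hx'
  rw [Finset.mem_inter] at hx'
  rcases hC x hx with h | h
  · exact (Finset.mem_sdiff.1 h).2 hx'.2
  · exact (Finset.mem_sdiff.1 h).2 hx'.1

theorem KSubset.elt_mem {k n : ℕ} (I : KSubset k n) (r : Fin k) : I.elt r ∈ I.1 :=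
  Finset.orderEmbOfFin_mem _ _ _

/-- `min(I,J) = min(I - J, J - I) ∪ (I ∩ J)`. -/
def KSubset.minSet {k n : ℕ} (I J : KSubset k n) : KSubset k n :=
  ⟨(termwiseMin (I.diffLeft J) (I.diffRight J)).1 ∪ (I.1 ∩ J.1),
    I.card_union_inter J _ (by
      intro x hx
      obtain ⟨r, -, rfl⟩ := Finset.mem_image.1 hx
      rcases min_choice ((I.diffLeft J).elt r) ((I.diffRight J).elt r) with h | h <;>
        simp only [h]
      · exact Or.inl (KSubset.elt_mem (I.diffLeft J) r)
      · exact Or.inr (KSubset.elt_mem (I.diffRight J) r))⟩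

/-- `max(I,J) = max(I - J, J - I) ∪ (I ∩ J)`. -/
def KSubset.maxSet {k n : ℕ} (I J : KSubset k n) : KSubset k n :=
  ⟨(termwiseMax (I.diffLeft J) (I.diffRight J)).1 ∪ (I.1 ∩ J.1),
    I.card_union_inter J _ (by
      intro x hx
      obtain ⟨r, -, rfl⟩ := Finset.mem_image.1 hx
      rcases max_choice ((I.diffLeft J).elt r) ((I.diffRight J).elt r) with h | h <;>
        simp only [h]
      · exact Or.inl (KSubset.elt_mem (I.diffLeft J) r)
      · exact Or.inr (KSubset.elt_mem (I.diffRight J) r))⟩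

/-- The multiset union of `I` and `J`, sorted into a weakly increasing list. -/
def KSubset.sortedUnion {k n : ℕ} (I J : KSubset k n) : List (Fin n) :=
  (I.1.val + J.1.val).sort (· ≤ ·)

theorem KSubset.length_sortedUnion {k n : ℕ} (I J : KSubset k n) :
    (I.sortedUnion J).length = 2 * k := by
  have hI : Multiset.card I.1.val = k := I.2
  have hJ : Multiset.card J.1.val = k := J.2
  rw [KSubset.sortedUnion, Multiset.length_sort, Multiset.card_add, hI, hJ]
  omega

/-- The `p`-th smallest element (counted from `0`) of the multiset union of `I` and `J`. -/
def KSubset.merged {k n : ℕ} (I J : KSubset k n) (p : Fin (2 * k)) : Fin n :=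
  (I.sortedUnion J).get (p.cast (I.length_sortedUnion J).symm)

theorem KSubset.merged_mono {k n : ℕ} (I J : KSubset k n) : Monotone (I.merged J) := by
  intro p q hpq
  have h : (I.sortedUnion J).Pairwise (· ≤ ·) := Multiset.pairwise_sort _ _
  exact h.sortedLE.monotone_get hpq

theorem KSubset.merged_lt {k n : ℕ} (I J : KSubset k n) (p q : Fin (2 * k))
    (hpq : p.1 + 2 ≤ q.1) : I.merged J p < I.merged J q := by
  refine lt_of_le_of_ne (I.merged_mono J (Fin.le_def.2 (by omega))) fun he => ?_
  have hcount : (I.sortedUnion J).count (I.merged J p) ≤ 2 := by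
    rw [← Multiset.coe_count, KSubset.sortedUnion, Multiset.sort_eq, Multiset.count_add]
    have h1 := Multiset.nodup_iff_count_le_one.1 I.1.nodup (I.merged J p)
    have h2 := Multiset.nodup_iff_count_le_one.1 J.1.nodup (I.merged J p)
    omega
  have hlen := I.length_sortedUnion J
  have hsub : List.Sublist (List.replicate 3 (I.merged J p)) (I.sortedUnion J) := by
    rw [List.sublist_iff_exists_fin_orderEmbedding_get_eq]
    have hq := q.2
    let f : Fin (List.replicate 3 (I.merged J p)).length → Fin (I.sortedUnion J).length :=
      fun t => ⟨p.1 + t.1, by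
        have := t.2
        simp only [List.length_replicate] at this
        omega⟩
    have hf : StrictMono f := fun a b hab => Fin.lt_def.2 (by
      have := Fin.lt_def.1 hab
      simp only [f]; omega)
    refine ⟨OrderEmbedding.ofStrictMono f hf, fun t => ?_⟩
    have ht := t.2
    simp only [List.length_replicate] at ht
    have h1 : I.merged J p ≤ I.merged J ⟨p.1 + t.1, by omega⟩ :=
      I.merged_mono J (Fin.le_def.2 (by simp))
    have h2 : I.merged J ⟨p.1 + t.1, by omega⟩ ≤ I.merged J q :=
      I.merged_mono J (Fin.le_def.2 (by simp only; omega))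
    have h3 := le_antisymm h1 (h2.trans he.ge)
    rw [List.get_eq_getElem, List.getElem_replicate]
    exact h3
  have := List.replicate_sublist_iff.1 hsub
  omega

/-- `sort₁(I,J) = {a₁, …, aₖ}`, where `a₁ ≤ b₁ ≤ a₂ ≤ b₂ ≤ ⋯ ≤ aₖ ≤ bₖ` is the sorted
multiset union of `I` and `J`. -/
def KSubset.sortOne {k n : ℕ} (I J : KSubset k n) : KSubset k n :=
  KSubset.ofInjective (fun r => I.merged J ⟨2 * r.1, by have := r.2; omega⟩) (by
    refine StrictMono.injective fun r s hrs => I.merged_lt J _ _ ?_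
    have := Fin.lt_def.1 hrs
    simp only; omega)

/-- `sort₂(I,J) = {b₁, …, bₖ}`, where `a₁ ≤ b₁ ≤ a₂ ≤ b₂ ≤ ⋯ ≤ aₖ ≤ bₖ` is the sorted
multiset union of `I` and `J`. -/
def KSubset.sortTwo {k n : ℕ} (I J : KSubset k n) : KSubset k n :=
  KSubset.ofInjective (fun r => I.merged J ⟨2 * r.1 + 1, by have := r.2; omega⟩) (by
    refine StrictMono.injective fun r s hrs => I.merged_lt J _ _ ?_
    have := Fin.lt_def.1 hrs
    simp only; omega)

/-! For a totally nonnegative point, Δ_I Δ_J as a function of (I, J) is a nonnegative combination of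
0/1 indicators, one for each noncrossing partial matching σ with a set S. The indicator asks that
each arc join a point of I \ J to a point of J \ I, and that each unmatched point lie in both sets
or in neither, as S prescribes (`matchingCone_minor_mul_minor`); this is an expansion of
Temperley–Lieb type. Hence Δ_I Δ_J ≤ Δ_I' Δ_J' as soon as every (σ, S) compatible with (I, J) is
compatible with (I', J') (`MatchingCone.le_of_compatible`).

That implication is counting. Under an arc, I \ J and J \ I have equally many points, so the surplus
of I \ J over J \ I to the left of a point changes by exactly one from one end of the arc to the
other. Membership in min(I,J) depends on the sign of this surplus and membership in sort₁(I,J) on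
its parity; both rules separate the two ends. This gives both inequalities, because sorting (min,
max) gives the same result as sorting (I, J).

The expansion is proved by induction on the number of nonzero minors of a vector configuration
realizing the point. If only one basis is left, a single indicator suffices. Otherwise there are
neighbouring i < j, apart from loops and coloops, such that replacing i by j keeps bases bases
(`exists_exchangeable`). Subtracting the largest admissible multiple of the i-th vector from the
j-th kills a minor and keeps total nonnegativity (`exists_reduction`). Undoing this subtraction is
`pushExchange`, which maps each indicator to a nonnegative combination of indicators by local
surgery on the arcs at i and j (`MatchingCone.pushExchange`). -/

/-! ### Plücker coordinates as maximal minors -/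

theorem KSubset.elt_strictMono {k n : ℕ} (I : KSubset k n) : StrictMono I.elt :=
  (I.1.orderEmbOfFin I.2).strictMono

theorem KSubset.ofInjective_elt_comp {k n : ℕ} (I : KSubset k n) (π : Equiv.Perm (Fin k))
    (h : Function.Injective (I.elt ∘ π)) : KSubset.ofInjective (I.elt ∘ π) h = I := by
  apply Subtype.ext
  ext x
  have hx : x ∈ I.1 ↔ x ∈ Set.range I.elt := by
    rw [KSubset.elt, Finset.range_orderEmbOfFin]; rfl
  rw [hx]
  simp only [KSubset.ofInjective, Finset.mem_image, Finset.mem_univ, true_and, Set.mem_range,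
    Function.comp]
  exact ⟨fun ⟨a, ha⟩ => ⟨π a, ha⟩, fun ⟨a, ha⟩ => ⟨π.symm a, by simpa using ha⟩⟩

theorem sort_comp_perm_of_strictMono {k n : ℕ} {u : Fin k → Fin n} (hu : StrictMono u)
    (π : Equiv.Perm (Fin k)) : Tuple.sort (u ∘ π) = π⁻¹ := by
  have h1 : Monotone ((u ∘ π) ∘ (Tuple.sort (u ∘ π))) := Tuple.monotone_sort _
  have h2 : Monotone ((u ∘ π) ∘ (π⁻¹ : Equiv.Perm (Fin k))) := by
    have : (u ∘ π) ∘ (π⁻¹ : Equiv.Perm (Fin k)) = u := by ext x; simp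
    rw [this]; exact hu.monotone
  have h3 := Tuple.unique_monotone h1 h2
  ext1 x
  exact (hu.injective.comp π.injective) (congrFun h3 x)

theorem pluckerBracket_elt_comp_perm {k n : ℕ} (X : KSubset k n → ℝ) (I : KSubset k n)
    (π : Equiv.Perm (Fin k)) :
    pluckerBracket X (I.elt ∘ π) = ((Equiv.Perm.sign π : ℤ) : ℝ) * X I := by
  have hi : Function.Injective (I.elt ∘ π) := I.elt_strictMono.injective.comp π.injective
  rw [pluckerBracket, dif_pos hi, sort_comp_perm_of_strictMono I.elt_strictMono,
    KSubset.ofInjective_elt_comp, Equiv.Perm.sign_inv]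

theorem pluckerBracket_elt {k n : ℕ} (X : KSubset k n → ℝ) (I : KSubset k n) :
    pluckerBracket X I.elt = X I := by
  simpa using pluckerBracket_elt_comp_perm X I 1

/-- The volume form on `ℝᵏ`. -/
noncomputable abbrev volumeForm (k : ℕ) : (Fin k → ℝ) [⋀^Fin k]→ₗ[ℝ] ℝ :=
  Matrix.detRowAlternating

/-- A nonzero point of the cone over the Grassmannian is a multiple of the family of maximal
minors of a configuration of vectors. -/
theorem exists_vectors_of_mem_grassmannianCone {k n : ℕ} {X : KSubset k n → ℝ}
    (hX : X ∈ grassmannianCone k n) (B : KSubset k n) (hB : X B ≠ 0) :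
    ∃ w : Fin n → Fin k → ℝ, ∀ I : KSubset k n, X I = X B * volumeForm k (w ∘ I.elt) := by
  set P := pluckerBracket X with hP
  set u := B.elt with hu
  have hPu : P u = X B := pluckerBracket_elt X B
  have hui : Function.Injective u := B.elt_strictMono.injective
  -- Cramer's rule: these are the coordinates of the c-th vector in the basis indexed by B.
  let w : Fin n → Fin k → ℝ := fun c s => P (Function.update u s c) / X B
  have hw : ∀ s, w (u s) = Pi.single s 1 := by
    intro s
    ext s'
    by_cases h : s' = s
    · subst h
      simp [w, hPu, hB]
    · rw [Pi.single_eq_of_ne h]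
      have : ¬ Function.Injective (Function.update u s' (u s)) := fun hi =>
        h (hi (a₁ := s') (a₂ := s) (by rw [Function.update_self, Function.update_of_ne (Ne.symm h)]))
      simp [w, hP, pluckerBracket, this]
  let f : (Fin k → Fin n) → ℝ := fun v => P v - X B * volumeForm k (w ∘ v)
  -- Both terms of f obey this expansion, the bracket by the Plücker relation against B and the
  -- determinant by multilinearity. It trades an entry of v for entries of B, so f vanishes once it
  -- vanishes on sequences in B.
  have hexp : ∀ v r, f v = ∑ s, w (v r) s * f (Function.update v r (u s)) := by
    intro v r
    have h1 : P v = ∑ s, w (v r) s * P (Function.update v r (u s)) := by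
      have := hX u v r
      rw [← hP, hPu] at this
      rw [← mul_right_inj' hB, this, Finset.mul_sum]
      refine Finset.sum_congr rfl fun s _ => ?_
      simp only [w]; field_simp
    have h2 : volumeForm k (w ∘ v) =
        ∑ s, w (v r) s * volumeForm k (w ∘ Function.update v r (u s)) := by
      have e : w (v r) = ∑ s, w (v r) s • (Pi.single s 1 : Fin k → ℝ) := by
        ext t; simp [Finset.sum_apply, Pi.single_apply]
      have e2 : w ∘ v = Function.update (w ∘ v) r (w (v r)) := by
        rw [← Function.comp_update, Function.update_eq_self]
      conv_lhs => rw [e2, e, AlternatingMap.map_update_sum]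
      refine Finset.sum_congr rfl fun s _ => ?_
      rw [AlternatingMap.map_update_smul, smul_eq_mul, Function.comp_update, hw]
    simp only [f]
    rw [h1, h2, Finset.mul_sum, ← Finset.sum_sub_distrib]
    exact Finset.sum_congr rfl fun s _ => by ring
  have hbase : ∀ s : Fin k → Fin k, f (u ∘ s) = 0 := by
    intro s
    by_cases hs : Function.Injective s
    · obtain ⟨π, rfl⟩ : ∃ π : Equiv.Perm (Fin k), ⇑π = s :=
        ⟨Equiv.ofBijective s (Finite.injective_iff_bijective.1 hs), rfl⟩
      have h1 : volumeForm k (w ∘ u ∘ π) = ((Equiv.Perm.sign π : ℤ) : ℝ) := by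
        have : w ∘ u = (1 : Matrix (Fin k) (Fin k) ℝ) := by
          ext a b; simp [hw, Matrix.one_apply, Pi.single_apply, eq_comm]
        rw [← Function.comp_assoc, AlternatingMap.map_perm, this]
        have h1 : volumeForm k (1 : Matrix (Fin k) (Fin k) ℝ) = 1 := Matrix.det_one
        rw [h1, Units.smul_def, zsmul_eq_mul, mul_one]
      simp only [f]
      rw [hP, hu, pluckerBracket_elt_comp_perm, ← hu, h1]; ring
    · have h1 : ¬ Function.Injective (u ∘ s) := fun h => hs h.of_comp
      have h2 : ¬ Function.Injective (w ∘ u ∘ s) := fun h => h1 h.of_comp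
      simp only [f]
      rw [AlternatingMap.map_eq_zero_of_not_injective _ _ h2, hP, pluckerBracket, dif_neg h1]
      simp
  have hzero : ∀ (m : ℕ) (v : Fin k → Fin n),
      (Finset.univ.filter fun r => v r ∉ Set.range u).card = m → f v = 0 := by
    classical
    intro m
    induction m with
    | zero =>
      intro v hv
      rw [Finset.card_eq_zero, Finset.filter_eq_empty_iff] at hv
      have : ∀ r, ∃ s, u s = v r := fun r => by simpa using hv (Finset.mem_univ r)
      choose s hs using this
      have : v = u ∘ s := by ext r; simp [hs]
      rw [this]; exact hbase s
    | succ m ih =>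
      intro v hv
      obtain ⟨r, hr⟩ := Finset.card_pos.1 (by omega : 0 < (Finset.univ.filter
        fun r => v r ∉ Set.range u).card)
      rw [hexp v r]
      refine Finset.sum_eq_zero fun s _ => ?_
      rw [ih, mul_zero]
      have : (Finset.univ.filter fun t => Function.update v r (u s) t ∉ Set.range u) =
          (Finset.univ.filter fun t => v t ∉ Set.range u).erase r := by
        ext t
        by_cases h : t = r
        · subst h; simp
        · simp [h]
      rw [this, Finset.card_erase_of_mem hr, hv]; rfl
  refine ⟨w, fun I => ?_⟩
  have h := hzero _ I.elt rfl
  simp only [f] at h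
  rw [hP, pluckerBracket_elt] at h
  linarith

/-! ### Noncrossing matchings, compatibility and surgery on arcs -/

section MatchingCone

variable {α : Type*} [LinearOrder α]

/-- An involution without crossings: its non-fixed points are joined in pairs by arcs that do not
cross. -/
structure IsNoncrossingMatching (σ : α → α) : Prop where
  invol : ∀ x, σ (σ x) = x
  noncrossing : ∀ x y, x < y → y < σ x → ¬ σ x < σ y

/-- A pair of sets is compatible with a partial matching `σ` and a set `S` if every arc of `σ`
joins a point that lies only in the first set with a point that lies only in the second, and a
fixed point lies in both sets if it is in `S`, in neither of them otherwise. -/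
def Compatible (σ : α → α) (S I J : Finset α) : Prop :=
  ∀ x, (x ∈ I ↔ σ x ∈ J) ∧ (σ x = x → (x ∈ I ↔ x ∈ S)) ∧ (σ x ≠ x → (x ∈ I ↔ x ∉ J))

open Classical in
/-- The indicator function of compatibility. -/
noncomputable def compatInd (σ : α → α) (S : Finset α) (I J : Finset α) : ℝ :=
  if Compatible σ S I J then 1 else 0

/-- The cone generated by the compatibility indicators of the noncrossing matchings that fix all
points of `Z`. -/
inductive MatchingCone (Z : Set α) : (Finset α → Finset α → ℝ) → Prop
  | ind (σ : α → α) (S : Finset α) (hσ : IsNoncrossingMatching σ) (hZ : ∀ z ∈ Z, σ z = z) :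
      MatchingCone Z (compatInd σ S)
  | add (f g : Finset α → Finset α → ℝ) : MatchingCone Z f → MatchingCone Z g →
      MatchingCone Z (fun I J => f I J + g I J)
  | smul (c : ℝ) (f : Finset α → Finset α → ℝ) : 0 ≤ c → MatchingCone Z f →
      MatchingCone Z (fun I J => c * f I J)

theorem MatchingCone.mono {Z Z' : Set α} (h : Z' ⊆ Z) {f : Finset α → Finset α → ℝ}
    (hf : MatchingCone Z f) : MatchingCone Z' f := by
  induction hf with
  | ind σ S hσ hZ => exact .ind σ S hσ fun z hz => hZ z (h hz)
  | add f g _ _ hf hg => exact .add f g hf hg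
  | smul c f hc _ hf => exact .smul c f hc hf

/-- The set obtained from `I` by exchanging `j` for `i`. -/
def exchange (i j : α) (I : Finset α) : Finset α := insert i (I.erase j)

theorem mem_exchange {i j x : α} {I : Finset α} :
    x ∈ exchange i j I ↔ x = i ∨ (x ≠ j ∧ x ∈ I) := by
  simp [exchange]

open Classical in
/-- The effect on functions `f I J = g I * g J` of adding to `g I`, for those `I` that contain `j`
and not `i`, the value at `exchange i j I` multiplied by `t`. -/
noncomputable def pushExchange (i j : α) (t : ℝ) (f : Finset α → Finset α → ℝ)
    (I J : Finset α) : ℝ :=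
  f I J + t * (if j ∈ I ∧ i ∉ I then f (exchange i j I) J else 0)
    + t * (if j ∈ J ∧ i ∉ J then f I (exchange i j J) else 0)
    + t ^ 2 * (if (j ∈ I ∧ i ∉ I) ∧ (j ∈ J ∧ i ∉ J) then f (exchange i j I) (exchange i j J) else 0)

theorem Compatible.mem_iff_of_apply_eq {α : Type*} {σ : α → α} {S I J : Finset α} (h : Compatible σ S I J)
    {x : α} (hx : σ x = x) : (x ∈ I ↔ x ∈ S) ∧ (x ∈ J ↔ x ∈ S) := by
  have := h x
  grind

section Cases

variable {i j : α} {σ : α → α} {S : Finset α}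

/-- An exchange puts i into one of the sets, while compatibility keeps the unmatched point i out of
both; all the added terms vanish. -/
theorem compatInd_pushExchange_of_not_mem (t : ℝ) (hi : σ i = i) (hiS : i ∉ S) :
    pushExchange i j t (compatInd σ S) = compatInd σ S := by
  funext I J
  have h1 : ¬ Compatible σ S (exchange i j I) J := fun h =>
    hiS ((h.mem_iff_of_apply_eq hi).1.1 (mem_exchange.2 (.inl rfl)))
  have h2 : ∀ I, ¬ Compatible σ S I (exchange i j J) := fun I h =>
    hiS ((h.mem_iff_of_apply_eq hi).2.1 (mem_exchange.2 (.inl rfl)))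
  simp [pushExchange, compatInd, h1, h2]

theorem compatInd_pushExchange_of_mem (hij : i < j) (t : ℝ) (hj : σ j = j) (hjS : j ∈ S) :
    pushExchange i j t (compatInd σ S) = compatInd σ S := by
  funext I J
  have h0 : ∀ I, j ∉ exchange i j I := fun I h => by
    rcases mem_exchange.1 h with h | h
    · exact hij.ne' h
    · exact h.1 rfl
  have h1 : ¬ Compatible σ S (exchange i j I) J := fun h =>
    h0 I ((h.mem_iff_of_apply_eq hj).1.2 hjS)
  have h2 : ∀ I, ¬ Compatible σ S I (exchange i j J) := fun I h =>
    h0 J ((h.mem_iff_of_apply_eq hj).2.2 hjS)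
  simp [pushExchange, compatInd, h1, h2]

/-- The matching `σ` with its arcs at `i` and `j` replaced by an arc between `i` and `j`. -/
def addArc (i j : α) (σ : α → α) (x : α) : α :=
  if x = i then j else if x = j then i else σ x

/-- The matching `σ`, which fixes `i`, with its arc at `j` moved to `i`. -/
def moveArc (i j : α) (σ : α → α) (x : α) : α :=
  if x = i then σ j else if x = j then j else if x = σ j then i else σ x

/-- The matching `σ` with its arc between `i` and `j` removed. -/
def removeArc (i j : α) (σ : α → α) (x : α) : α :=
  if x = i ∨ x = j then x else σ x

/-- The matching `σ` with its arcs at `i` and `j` removed and their other ends joined. -/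
def joinArcs (i j : α) (σ : α → α) (x : α) : α :=
  if x = i ∨ x = j then x else if x = σ i then σ j else if x = σ j then σ i else σ x

/-- Everything strictly between i and j is unmatched, so the new arc has nothing to cross. In the
other surgeries the same fact makes i and j act as a single place on the line. -/
theorem IsNoncrossingMatching.addArc (hσ : IsNoncrossingMatching σ) (hij : i < j)
    (hbet : ∀ z, i < z → z < j → σ z = z) (hi : σ i = i) (hj : σ j = j) :
    IsNoncrossingMatching (addArc i j σ) := by
  obtain ⟨h1, h2⟩ := hσ
  constructor
  · intro x; have := h1 x; grind [_root_.addArc]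
  · intro x y; have := h2 x y; have := h1 x; have := h1 y; have := hbet x; have := hbet y
    grind [_root_.addArc]

theorem IsNoncrossingMatching.moveArc (hσ : IsNoncrossingMatching σ) (hij : i < j)
    (hbet : ∀ z, i < z → z < j → σ z = z) (hi : σ i = i) (hj : σ j ≠ j) :
    IsNoncrossingMatching (moveArc i j σ) := by
  obtain ⟨h1, h2⟩ := hσ
  constructor
  · intro x; have := h1 x; grind (splits := 40) [_root_.moveArc]
  · intro x y
    have := lt_trichotomy x i; have := lt_trichotomy y i
    have := lt_trichotomy x j; have := lt_trichotomy y j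
    have := lt_trichotomy (σ x) i; have := lt_trichotomy (σ y) i
    have := lt_trichotomy (σ x) j; have := lt_trichotomy (σ y) j
    have := lt_trichotomy (σ j) i; have := lt_trichotomy (σ j) j
    grind (splits := 40) [_root_.moveArc]

theorem IsNoncrossingMatching.moveArc' (hσ : IsNoncrossingMatching σ) (hij : i < j)
    (hbet : ∀ z, i < z → z < j → σ z = z) (hi : σ i ≠ i) (hj : σ j = j) :
    IsNoncrossingMatching (_root_.moveArc j i σ) := by
  obtain ⟨h1, h2⟩ := hσ
  constructor
  · intro x; have := h1 x; grind (splits := 40) [_root_.moveArc]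
  · intro x y
    have := lt_trichotomy x i; have := lt_trichotomy y i
    have := lt_trichotomy x j; have := lt_trichotomy y j
    have := lt_trichotomy (σ x) i; have := lt_trichotomy (σ y) i
    have := lt_trichotomy (σ x) j; have := lt_trichotomy (σ y) j
    have := lt_trichotomy (σ i) i; have := lt_trichotomy (σ i) j
    grind (splits := 40) [_root_.moveArc]

theorem IsNoncrossingMatching.removeArc (hσ : IsNoncrossingMatching σ) (hi : σ i = j) :
    IsNoncrossingMatching (removeArc i j σ) := by
  obtain ⟨h1, h2⟩ := hσ
  have := h1 i
  constructor
  · intro x; have := h1 x; grind [_root_.removeArc]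
  · intro x y; have := h2 x y; have := h1 x; have := h1 y
    grind [_root_.removeArc]

theorem IsNoncrossingMatching.joinArcs (hσ : IsNoncrossingMatching σ) (hij : i < j)
    (hbet : ∀ z, i < z → z < j → σ z = z) (hi : σ i ≠ i) (hj : σ j ≠ j) (hn : σ i ≠ j) :
    IsNoncrossingMatching (joinArcs i j σ) := by
  obtain ⟨h1, h2⟩ := hσ
  have := h1 i
  have := h1 j
  constructor
  · intro x; have := h1 x; grind (splits := 40) [_root_.joinArcs]
  · intro x y
    have := lt_trichotomy x i; have := lt_trichotomy y i
    have := lt_trichotomy x j; have := lt_trichotomy y j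
    have := lt_trichotomy (σ x) i; have := lt_trichotomy (σ y) i
    have := lt_trichotomy (σ x) j; have := lt_trichotomy (σ y) j
    have := lt_trichotomy (σ i) i; have := lt_trichotomy (σ i) j
    have := lt_trichotomy (σ j) i; have := lt_trichotomy (σ j) j
    have := lt_trichotomy (σ i) (σ j)
    have := lt_trichotomy (σ x) (σ j)
    have := lt_trichotomy (σ y) (σ j)
    grind (splits := 40) [_root_.joinArcs]

end Cases
end MatchingCone

/-! ### The effect of an exchange on compatibility indicators -/

section MatchingCone

variable {α : Type*} [LinearOrder α] {i j : α} {σ : α → α} {S : Finset α}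

theorem compatible_addArc_iff (hij : i < j) (h1 : ∀ x, σ (σ x) = x) (hi : σ i = i) (hiS : i ∈ S)
    (hj : σ j = j) (hjS : j ∉ S) (I J : Finset α) :
    Compatible (addArc i j σ) S I J ↔
      ((j ∈ I ∧ i ∉ I) ∧ Compatible σ S (exchange i j I) J) ∨
      ((j ∈ J ∧ i ∉ J) ∧ Compatible σ S I (exchange i j J)) := by
  have := hij.ne
  constructor
  · intro h
    -- The arc between i and j has one end in each set; the set containing j is the one that was
    -- exchanged.
    have hhi := h i
    have hhj := h j
    by_cases hc : j ∈ I
    · left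
      refine ⟨by grind [addArc], fun x => ?_⟩
      have := h x
      grind [addArc, mem_exchange]
    · right
      refine ⟨by grind [addArc], fun x => ?_⟩
      have := h x
      grind [addArc, mem_exchange]
  · rintro (⟨h0, h⟩ | ⟨h0, h⟩) x
    all_goals
      have hhi := h i
      have hhj := h j
      have := h x
      grind [addArc, mem_exchange]

theorem compatible_exchange_exchange_iff (hij : i < j) (h1 : ∀ x, σ (σ x) = x) (hi : σ i = i)
    (hiS : i ∈ S) (hj : σ j = j) (hjS : j ∉ S) (I J : Finset α) :
    Compatible σ (exchange j i S) I J ↔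
      ((j ∈ I ∧ i ∉ I) ∧ (j ∈ J ∧ i ∉ J)) ∧ Compatible σ S (exchange i j I) (exchange i j J) := by
  have := hij.ne
  constructor
  · intro h
    have hhi := h i
    have hhj := h j
    refine ⟨by grind [mem_exchange], fun x => ?_⟩
    have := h x
    grind [mem_exchange]
  · rintro ⟨h0, h⟩ x
    have hhi := h i
    have hhj := h j
    have := h x
    grind [mem_exchange]

/-- Before the exchange i lies in both sets and j in only one. Replacing i by j in the set without j
puts j in both and leaves i in the other set only, so i inherits the arc of j. -/
theorem compatible_moveArc_iff (hij : i < j) (h1 : ∀ x, σ (σ x) = x) (hi : σ i = i) (hiS : i ∈ S)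
    (hj : σ j ≠ j) (I J : Finset α) :
    Compatible (moveArc i j σ) (insert j S) I J ↔
      ((j ∈ I ∧ i ∉ I) ∧ Compatible σ S (exchange i j I) J) ∨
      ((j ∈ J ∧ i ∉ J) ∧ Compatible σ S I (exchange i j J)) := by
  have := hij.ne
  have := h1 j
  constructor
  · intro h
    have hhi := h i
    have hhj := h j
    have hha := h (σ j)
    by_cases hc : i ∈ I
    · right
      refine ⟨by grind [moveArc], fun x => ?_⟩
      have := h x
      have := h1 x
      grind [moveArc, mem_exchange]
    · left
      refine ⟨by grind [moveArc], fun x => ?_⟩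
      have := h x
      have := h1 x
      grind [moveArc, mem_exchange]
  · rintro (⟨h0, h⟩ | ⟨h0, h⟩) x
    all_goals
      have hhi := h i
      have hhj := h j
      have hha := h (σ j)
      have := h x
      have := h1 x
      grind [moveArc, mem_exchange]

theorem compatible_moveArc_iff' (hij : i < j) (h1 : ∀ x, σ (σ x) = x) (hi : σ i ≠ i)
    (hj : σ j = j) (hjS : j ∉ S) (I J : Finset α) :
    Compatible (moveArc j i σ) (S.erase i) I J ↔
      ((j ∈ I ∧ i ∉ I) ∧ Compatible σ S (exchange i j I) J) ∨
      ((j ∈ J ∧ i ∉ J) ∧ Compatible σ S I (exchange i j J)) := by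
  have := hij.ne
  have := h1 i
  constructor
  · intro h
    have hhi := h i
    have hhj := h j
    have hha := h (σ i)
    by_cases hc : j ∈ I
    · left
      refine ⟨by grind [moveArc], fun x => ?_⟩
      have := h x
      have := h1 x
      grind [moveArc, mem_exchange]
    · right
      refine ⟨by grind [moveArc], fun x => ?_⟩
      have := h x
      have := h1 x
      grind [moveArc, mem_exchange]
  · rintro (⟨h0, h⟩ | ⟨h0, h⟩) x
    all_goals
      have hhi := h i
      have hhj := h j
      have hha := h (σ i)
      have := h x
      have := h1 x
      grind [moveArc, mem_exchange]

/-- The exchange is possible only when i and j lie in opposite sets. Then so do σ i and σ j, which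
can be joined, while j ends up in both sets and i in neither. -/
theorem compatible_joinArcs_iff (hij : i < j) (h1 : ∀ x, σ (σ x) = x) (hi : σ i ≠ i)
    (hj : σ j ≠ j) (hn : σ i ≠ j) (I J : Finset α) :
    Compatible (joinArcs i j σ) (exchange j i S) I J ↔
      ((j ∈ I ∧ i ∉ I) ∧ Compatible σ S (exchange i j I) J) ∨
      ((j ∈ J ∧ i ∉ J) ∧ Compatible σ S I (exchange i j J)) := by
  have := hij.ne
  have := h1 i
  have := h1 j
  constructor
  · intro h
    have hhi := h i
    have hhj := h j
    have hha := h (σ i)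
    have hhb := h (σ j)
    by_cases hc : σ i ∈ J
    · left
      refine ⟨by grind (splits := 30) [joinArcs, mem_exchange], fun x => ?_⟩
      have := h x
      have := h1 x
      grind (splits := 30) [joinArcs, mem_exchange]
    · right
      refine ⟨by grind (splits := 30) [joinArcs, mem_exchange], fun x => ?_⟩
      have := h x
      have := h1 x
      grind (splits := 30) [joinArcs, mem_exchange]
  · rintro (⟨h0, h⟩ | ⟨h0, h⟩) x
    all_goals
      have hhi := h i
      have hhj := h j
      have hha := h (σ i)
      have hhb := h (σ j)
      have := h x
      have := h1 x
      grind (splits := 30) [joinArcs, mem_exchange]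

theorem compatible_removeArc_iff (hij : i < j) (h1 : ∀ x, σ (σ x) = x) (hi : σ i = j)
    (I J : Finset α) :
    (Compatible (removeArc i j σ) (exchange j i S) I J ↔
      (j ∈ I ∧ i ∉ I) ∧ Compatible σ S (exchange i j I) J) := by
  have := hij.ne
  have := h1 i
  constructor
  · intro h
    have hhi := h i
    have hhj := h j
    refine ⟨by grind [removeArc, mem_exchange], fun x => ?_⟩
    have := h x
    have := h1 x
    grind [removeArc, mem_exchange]
  · rintro ⟨h0, h⟩ x
    have hhi := h i
    have hhj := h j
    have := h x
    have := h1 x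
    grind [removeArc, mem_exchange]

theorem compatible_removeArc_iff' (hij : i < j) (h1 : ∀ x, σ (σ x) = x) (hi : σ i = j)
    (I J : Finset α) :
    (Compatible (removeArc i j σ) (exchange j i S) I J ↔
      (j ∈ J ∧ i ∉ J) ∧ Compatible σ S I (exchange i j J)) := by
  have := hij.ne
  have := h1 i
  constructor
  · intro h
    have hhi := h i
    have hhj := h j
    refine ⟨by grind [removeArc, mem_exchange], fun x => ?_⟩
    have := h x
    have := h1 x
    grind [removeArc, mem_exchange]
  · rintro ⟨h0, h⟩ x
    have hhi := h i
    have hhj := h j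
    have := h x
    have := h1 x
    grind [removeArc, mem_exchange]

theorem not_compatible_exchange_exchange (hij : i < j) (h : σ i ≠ i ∨ σ j ≠ j) (I J : Finset α) :
    ¬ Compatible σ S (exchange i j I) (exchange i j J) := by
  intro hc
  have := hij.ne
  have := hc i
  have := hc j
  grind [mem_exchange]

-- By `hand` the two single exchanges are never compatible at once, so the sum of their indicators
-- is the indicator of the disjunction in `hor`.
open Classical in
theorem pushExchange_compatInd_of_iff {σ' : α → α} {S' : Finset α} (t : ℝ)
    (hor : ∀ I J, Compatible σ' S' I J ↔
      ((j ∈ I ∧ i ∉ I) ∧ Compatible σ S (exchange i j I) J) ∨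
      ((j ∈ J ∧ i ∉ J) ∧ Compatible σ S I (exchange i j J)))
    (hand : ∀ I J, (j ∈ I ∧ i ∉ I) → Compatible σ S (exchange i j I) J → (j ∈ J ∧ i ∉ J) →
      ¬ Compatible σ S I (exchange i j J)) :
    pushExchange i j t (compatInd σ S) = fun I J => compatInd σ S I J + t * compatInd σ' S' I J +
      t ^ 2 * (if ((j ∈ I ∧ i ∉ I) ∧ (j ∈ J ∧ i ∉ J)) ∧
        Compatible σ S (exchange i j I) (exchange i j J) then 1 else 0) := by
  funext I J
  have h1 := hor I J
  have h2 := hand I J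
  simp only [pushExchange, compatInd, ← ite_and]
  generalize Compatible σ' S' I J = p at *
  generalize Compatible σ S (exchange i j I) J = q at *
  generalize Compatible σ S I (exchange i j J) = r at *
  clear hor hand
  by_cases ha : j ∈ I ∧ i ∉ I <;> by_cases hb : j ∈ J ∧ i ∉ J <;> by_cases hq : q <;>
    by_cases hr : r <;> simp only [ha, hb, hq, hr] at h1 h2 ⊢ <;> simp_all

/-- By linearity one indicator is enough, and the cases are whether i and j are matched and, if not,
whether S contains them. Points of Z stay unmatched because surgery changes arcs only at i, j and
their partners, none of which lies in Z. -/
theorem MatchingCone.pushExchange {Z : Set α} (hij : i < j) (hbet : ∀ z, i < z → z < j → z ∈ Z)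
    (hi : i ∉ Z) (hj : j ∉ Z) {t : ℝ} (ht : 0 ≤ t) {f : Finset α → Finset α → ℝ}
    (hf : MatchingCone Z f) : MatchingCone Z (pushExchange i j t f) := by
  classical
  induction hf with
  | add f g _ _ hf hg =>
    convert MatchingCone.add _ _ hf hg using 1
    funext I J
    simp only [_root_.pushExchange]
    split_ifs <;> ring
  | smul c f hc _ hf =>
    convert MatchingCone.smul c _ hc hf using 1
    funext I J
    simp only [_root_.pushExchange]
    split_ifs <;> ring
  | ind σ S hσ hZ =>
    have hb : ∀ z, i < z → z < j → σ z = z := fun z h1 h2 => hZ z (hbet z h1 h2)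
    have hne := hij.ne
    have h0 := MatchingCone.ind σ S hσ hZ
    have hself : ∀ z ∈ Z, z ≠ i ∧ z ≠ j := fun z hz => ⟨fun h => hi (h ▸ hz), fun h => hj (h ▸ hz)⟩
    by_cases hi' : σ i = i <;> by_cases hj' : σ j = j
    · by_cases hiS : i ∈ S
      · by_cases hjS : j ∈ S
        · rwa [compatInd_pushExchange_of_mem hij t hj' hjS]
        · rw [pushExchange_compatInd_of_iff t
            (compatible_addArc_iff hij hσ.invol hi' hiS hj' hjS)]
          · have h1 := MatchingCone.ind (Z := Z) (addArc i j σ) S (hσ.addArc hij hb hi' hj')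
              (fun z hz => by have := hself z hz; have := hZ z hz; simp [addArc, *])
            have h2 := MatchingCone.ind σ (exchange j i S) hσ hZ
            convert ((h0.add _ _ (h1.smul t _ ht)).add _ _ (h2.smul (t ^ 2) _ (by positivity)))
              using 1
            funext I J
            have := compatible_exchange_exchange_iff hij hσ.invol hi' hiS hj' hjS I J
            simp [compatInd, this]
          · intro I J h1 h2 h3 h4
            have := h2 j
            have := h4 j
            grind [mem_exchange]
      · rwa [compatInd_pushExchange_of_not_mem t hi' hiS]
    · by_cases hiS : i ∈ S
      · rw [pushExchange_compatInd_of_iff t (compatible_moveArc_iff hij hσ.invol hi' hiS hj')]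
        · have h1 := MatchingCone.ind (Z := Z) (moveArc i j σ) (insert j S)
              (hσ.moveArc hij hb hi' hj')
              (fun z hz => by have := hself z hz; have := hZ z hz; have := hσ.invol j
                              grind [moveArc])
          convert (h0.add _ _ (h1.smul t _ ht)) using 1
          funext I J
          simp [not_compatible_exchange_exchange hij (.inr hj')]
        · intro I J h1 h2 h3 h4
          have := h2 i
          have := h4 i
          grind [mem_exchange]
      · rwa [compatInd_pushExchange_of_not_mem t hi' hiS]
    · by_cases hjS : j ∈ S
      · rwa [compatInd_pushExchange_of_mem hij t hj' hjS]
      · rw [pushExchange_compatInd_of_iff t (compatible_moveArc_iff' hij hσ.invol hi' hj' hjS)]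
        · have h1 := MatchingCone.ind (Z := Z) (moveArc j i σ) (S.erase i)
              (hσ.moveArc' hij hb hi' hj')
              (fun z hz => by have := hself z hz; have := hZ z hz; have := hσ.invol i
                              grind [moveArc])
          convert (h0.add _ _ (h1.smul t _ ht)) using 1
          funext I J
          simp [not_compatible_exchange_exchange hij (.inl hi')]
        · intro I J h1 h2 h3 h4
          have := h2 j
          have := h4 j
          grind [mem_exchange]
    · by_cases hn : σ i = j
      · have h1 := MatchingCone.ind (Z := Z) (removeArc i j σ) (exchange j i S)
              (hσ.removeArc hn)
              (fun z hz => by have := hZ z hz; simp [removeArc, *])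
        -- When i and j are joined to each other, the two single exchanges lead to the same
        -- condition and both contribute: hence 2t.
        convert (h0.add _ _ (h1.smul (2 * t) _ (by positivity))) using 1
        funext I J
        have e1 := compatible_removeArc_iff (S := S) hij hσ.invol hn I J
        have e2 := compatible_removeArc_iff' (S := S) hij hσ.invol hn I J
        simp only [_root_.pushExchange, compatInd, ← ite_and, ← e1, ← e2,
          not_compatible_exchange_exchange hij (.inl hi')]
        simp only [and_false, if_false]
        ring
      · rw [pushExchange_compatInd_of_iff t (compatible_joinArcs_iff hij hσ.invol hi' hj' hn)]
        · have h1 := MatchingCone.ind (Z := Z) (joinArcs i j σ) (exchange j i S)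
              (hσ.joinArcs hij hb hi' hj' hn)
              (fun z hz => by have := hself z hz; have := hZ z hz; have := hσ.invol i
                              have := hσ.invol j; grind [joinArcs])
          convert (h0.add _ _ (h1.smul t _ ht)) using 1
          funext I J
          simp [not_compatible_exchange_exchange hij (.inl hi')]
        · intro I J h1 h2 h3 h4
          have := h2 i
          have := h4 i
          have := h2 j
          have := h4 j
          have := h2 (σ i)
          have := h4 (σ i)
          grind [mem_exchange]

end MatchingCone

/-! ### Balance under the arcs of a compatible matching -/

/-- The number of elements of `A` below `x`. -/
def countBelow {α : Type*} [LinearOrder α] (A : Finset α) (x : α) : ℕ := (A.filter (· < x)).card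

section Counting

variable {α : Type*} [LinearOrder α] {σ : α → α} {S I J : Finset α}

theorem IsNoncrossingMatching.mem_Ioo (hσ : IsNoncrossingMatching σ) {p z : α} (hpz : p < z)
    (hz : z < σ p) : p < σ z ∧ σ z < σ p := by
  have h1 := hσ.invol p
  have h2 := hσ.invol z
  have h3 := hσ.noncrossing p z hpz hz
  have h4 := hσ.noncrossing (σ z) p
  rw [h2] at h4
  constructor
  · refine lt_of_le_of_ne (not_lt.1 fun h => h4 h hpz hz) ?_
    rintro rfl
    exact hz.ne h2.symm
  · refine lt_of_le_of_ne (not_lt.1 h3) ?_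
    intro h
    rw [h, h1] at h2
    exact hpz.ne h2

theorem Compatible.mem_sdiff_iff (h : Compatible σ S I J) (hσ : IsNoncrossingMatching σ) (x : α) :
    (x ∈ I \ J ↔ σ x ∈ J \ I) := by
  have h1 := h x
  have h2 := h (σ x)
  have h3 := hσ.invol x
  grind

theorem countBelow_eq_add {p q : α} (hpq : p < q) (A : Finset α) :
    countBelow A q =
      countBelow A p + (A.filter fun z => p < z ∧ z < q).card + if p ∈ A then 1 else 0 := by
  have h : A.filter (· < q) = (A.filter (· < p) ∪ A.filter fun z => p < z ∧ z < q) ∪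
      (A.filter (· = p)) := by
    ext z
    simp only [Finset.mem_filter, Finset.mem_union]
    have := lt_trichotomy z p
    grind
  rw [countBelow, h, Finset.card_union_of_disjoint, Finset.card_union_of_disjoint, countBelow,
    Finset.filter_eq']
  · split_ifs <;> simp
  · rw [Finset.disjoint_left]; intro z; simp only [Finset.mem_filter]
    exact fun h1 h2 => lt_asymm h1.2 h2.2.1
  · rw [Finset.disjoint_left]; intro z; simp only [Finset.mem_filter, Finset.mem_union]
    rintro h1 ⟨-, rfl⟩
    simp at h1

/-- Between the ends of an arc of a compatible noncrossing matching there are as many points of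
`I \ J` as of `J \ I`. -/
theorem Compatible.card_Ioo (h : Compatible σ S I J) (hσ : IsNoncrossingMatching σ) (p : α) :
    ((I \ J).filter fun z => p < z ∧ z < σ p).card =
      ((J \ I).filter fun z => p < z ∧ z < σ p).card := by
  refine Finset.card_bij' (fun z _ => σ z) (fun z _ => σ z) ?_ ?_ ?_ ?_
  · intro z hz
    rw [Finset.mem_filter] at hz ⊢
    exact ⟨(h.mem_sdiff_iff hσ z).1 hz.1, hσ.mem_Ioo hz.2.1 hz.2.2⟩
  · intro z hz
    rw [Finset.mem_filter] at hz ⊢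
    refine ⟨(h.mem_sdiff_iff hσ _).2 ?_, hσ.mem_Ioo hz.2.1 hz.2.2⟩
    rw [hσ.invol]; exact hz.1
  · exact fun z _ => hσ.invol z
  · exact fun z _ => hσ.invol z

/-- To check compatibility of a pair of sets with a matching that is compatible with `I` and `J`,
it is enough to check the arcs. -/
theorem Compatible.of_arcs (h : Compatible σ S I J) (hσ : IsNoncrossingMatching σ) {I' J' : Finset α}
    (hsum : ∀ x, (x ∈ I' ∧ x ∈ J' ↔ x ∈ I ∧ x ∈ J) ∧ (x ∈ I' ∨ x ∈ J' ↔ x ∈ I ∨ x ∈ J))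
    (harc : ∀ p m, p < σ p →
      countBelow (I \ J) (σ p) = countBelow (I \ J) p + m + (if p ∈ I \ J then 1 else 0) →
      countBelow (J \ I) (σ p) = countBelow (J \ I) p + m + (if p ∈ J \ I then 1 else 0) →
      (p ∈ I \ J ↔ p ∉ J \ I) → (p ∈ I \ J ↔ σ p ∈ J \ I) → (σ p ∈ I \ J ↔ p ∈ J \ I) →
      (p ∈ I' ↔ σ p ∉ I')) : Compatible σ S I' J' := by
  have key : ∀ p, p < σ p → (p ∈ I' ↔ σ p ∉ I') := by
    intro p hp
    refine harc p _ hp (countBelow_eq_add hp _) ?_ ?_ (h.mem_sdiff_iff hσ p) ?_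
    · rw [h.card_Ioo hσ p]; exact countBelow_eq_add hp _
    · have := h p
      have := hp.ne'
      grind
    · rw [h.mem_sdiff_iff hσ (σ p), hσ.invol]
  intro x
  have h1 := h x
  have h2 := h (σ x)
  have h3 := hσ.invol x
  have h4 := hsum x
  have h5 := hsum (σ x)
  have h6 := key x
  have h7 := key (σ x)
  rw [h3] at h7
  rcases lt_trichotomy x (σ x) with hx | hx | hx
  · have := h6 hx
    have := hx.ne
    grind
  · grind
  · have := h7 hx
    have := hx.ne
    grind

end Counting

/-! ### Min, max and sort in terms of counting -/

section KSubset

variable {k n : ℕ}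

theorem KSubset.mem_iff_exists_elt (A : KSubset k n) (x : Fin n) : x ∈ A.1 ↔ ∃ r, A.elt r = x := by
  have : x ∈ A.1 ↔ x ∈ Set.range A.elt := by
    rw [KSubset.elt, Finset.range_orderEmbOfFin]; rfl
  exact this

theorem KSubset.lt_countBelow_iff (A : KSubset k n) (x : Fin n) (r : Fin k) :
    r.1 < countBelow A.1 x ↔ A.elt r < x := by
  rw [← Tuple.lt_card_lt_iff_apply_lt_of_monotone A.elt_strictMono.monotone]
  have h : A.1.filter (· < x) = (Finset.univ.filter fun i => A.elt i < x).image A.elt := by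
    ext z
    simp only [Finset.mem_filter, Finset.mem_image, Finset.mem_univ, true_and,
      A.mem_iff_exists_elt]
    constructor
    · rintro ⟨⟨r, rfl⟩, h⟩; exact ⟨r, h, rfl⟩
    · rintro ⟨r, h, rfl⟩; exact ⟨⟨r, rfl⟩, h⟩
  rw [countBelow, h, Finset.card_image_of_injective _ A.elt_strictMono.injective]

theorem KSubset.countBelow_elt (A : KSubset k n) (r : Fin k) : countBelow A.1 (A.elt r) = r := by
  have h1 : ¬ r.1 < countBelow A.1 (A.elt r) := by rw [A.lt_countBelow_iff]; exact lt_irrefl _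
  by_contra h
  have h2 : countBelow A.1 (A.elt r) < r := by omega
  have h3 := (A.lt_countBelow_iff (A.elt r) ⟨_, h2.trans r.2⟩).2 (A.elt_strictMono h2)
  exact lt_irrefl _ h3

/-- If x is the r-th element of A, counted from 0, then r elements of A lie below it, and x is at
most the r-th element of B exactly when at most r elements of B lie below x. -/
theorem mem_termwiseMin {A B : KSubset k n} {x : Fin n} :
    x ∈ (termwiseMin A B).1 ↔ (x ∈ A.1 ∧ countBelow B.1 x ≤ countBelow A.1 x) ∨
      (x ∈ B.1 ∧ countBelow A.1 x ≤ countBelow B.1 x) := by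
  simp only [termwiseMin, KSubset.ofInjective, Finset.mem_image, Finset.mem_univ, true_and]
  constructor
  · rintro ⟨r, rfl⟩
    rcases le_total (A.elt r) (B.elt r) with h | h
    · left
      rw [min_eq_left h, A.countBelow_elt]
      exact ⟨A.elt_mem r, not_lt.1 fun h' => not_lt.2 h ((B.lt_countBelow_iff _ _).1 h')⟩
    · right
      rw [min_eq_right h, B.countBelow_elt]
      exact ⟨B.elt_mem r, not_lt.1 fun h' => not_lt.2 h ((A.lt_countBelow_iff _ _).1 h')⟩
  · rintro (⟨h, h'⟩ | ⟨h, h'⟩)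
    · obtain ⟨r, rfl⟩ := (A.mem_iff_exists_elt x).1 h
      rw [A.countBelow_elt] at h'
      exact ⟨r, min_eq_left (not_lt.1 fun h2 => not_lt.2 h' ((B.lt_countBelow_iff _ _).2 h2))⟩
    · obtain ⟨r, rfl⟩ := (B.mem_iff_exists_elt x).1 h
      rw [B.countBelow_elt] at h'
      exact ⟨r, min_eq_right (not_lt.1 fun h2 => not_lt.2 h' ((A.lt_countBelow_iff _ _).2 h2))⟩

theorem mem_termwiseMax {A B : KSubset k n} (hAB : Disjoint A.1 B.1) {x : Fin n} :
    x ∈ (termwiseMax A B).1 ↔ (x ∈ A.1 ∧ countBelow A.1 x < countBelow B.1 x) ∨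
      (x ∈ B.1 ∧ countBelow B.1 x < countBelow A.1 x) := by
  have hne : ∀ r s, A.elt r ≠ B.elt s := fun r s h =>
    Finset.disjoint_left.1 hAB (A.elt_mem r) (h ▸ B.elt_mem s)
  simp only [termwiseMax, KSubset.ofInjective, Finset.mem_image, Finset.mem_univ, true_and]
  constructor
  · rintro ⟨r, rfl⟩
    rcases lt_or_gt_of_ne (hne r r) with h | h
    · right
      rw [max_eq_right h.le, B.countBelow_elt]
      exact ⟨B.elt_mem r, (A.lt_countBelow_iff _ _).2 h⟩
    · left
      rw [max_eq_left h.le, A.countBelow_elt]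
      exact ⟨A.elt_mem r, (B.lt_countBelow_iff _ _).2 h⟩
  · rintro (⟨h, h'⟩ | ⟨h, h'⟩)
    · obtain ⟨r, rfl⟩ := (A.mem_iff_exists_elt x).1 h
      rw [A.countBelow_elt] at h'
      exact ⟨r, max_eq_left ((B.lt_countBelow_iff _ _).1 h').le⟩
    · obtain ⟨r, rfl⟩ := (B.mem_iff_exists_elt x).1 h
      rw [B.countBelow_elt] at h'
      exact ⟨r, max_eq_right ((A.lt_countBelow_iff _ _).1 h').le⟩

variable (I J : KSubset k n)

theorem KSubset.mem_minSet {x : Fin n} : x ∈ (I.minSet J).1 ↔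
    (x ∈ I.1 \ J.1 ∧ countBelow (J.1 \ I.1) x ≤ countBelow (I.1 \ J.1) x) ∨
      (x ∈ J.1 \ I.1 ∧ countBelow (I.1 \ J.1) x ≤ countBelow (J.1 \ I.1) x) ∨
      (x ∈ I.1 ∧ x ∈ J.1) := by
  have h := mem_termwiseMin (A := I.diffLeft J) (B := I.diffRight J) (x := x)
  simp only [KSubset.minSet, Finset.mem_union, h, Finset.mem_inter, or_assoc]
  rfl

theorem KSubset.mem_maxSet {x : Fin n} : x ∈ (I.maxSet J).1 ↔
    (x ∈ I.1 \ J.1 ∧ countBelow (I.1 \ J.1) x < countBelow (J.1 \ I.1) x) ∨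
      (x ∈ J.1 \ I.1 ∧ countBelow (J.1 \ I.1) x < countBelow (I.1 \ J.1) x) ∨
      (x ∈ I.1 ∧ x ∈ J.1) := by
  have hd : Disjoint (I.diffLeft J).1 (I.diffRight J).1 := by
    rw [Finset.disjoint_left]
    intro z h1 h2
    exact (Finset.mem_sdiff.1 h1).2 (Finset.mem_sdiff.1 h2).1
  have h := mem_termwiseMax hd (x := x)
  simp only [KSubset.maxSet, Finset.mem_union, h, Finset.mem_inter, or_assoc]
  rfl

/-- Let d be the surplus of I \ J over J \ I below the left end p of an arc. If p is in I \ J, it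
goes to the minimum iff d ≥ 0, and σ p goes there iff d + 1 ≤ 0: exactly one of them does. The case
p in J \ I is symmetric. -/
theorem Compatible.minSet_maxSet {σ : Fin n → Fin n} {S : Finset (Fin n)} {I J : KSubset k n}
    (h : Compatible σ S I.1 J.1) (hσ : IsNoncrossingMatching σ) :
    Compatible σ S (I.minSet J).1 (I.maxSet J).1 := by
  refine h.of_arcs hσ (fun x => ?_) ?_
  · rw [KSubset.mem_minSet, KSubset.mem_maxSet]
    simp only [Finset.mem_sdiff]
    have := le_or_gt (countBelow (J.1 \ I.1) x) (countBelow (I.1 \ J.1) x)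
    have := le_or_gt (countBelow (I.1 \ J.1) x) (countBelow (J.1 \ I.1) x)
    grind
  · intro p m _ h1 h2 h3 h4 h5
    rw [KSubset.mem_minSet, KSubset.mem_minSet]
    simp only [Finset.mem_sdiff] at *
    grind

theorem KSubset.map_merged : Finset.univ.val.map (I.merged J) = I.1.val + J.1.val := by
  have h : List.ofFn (I.merged J) = I.sortedUnion J := by
    conv_rhs => rw [← List.ofFn_get (I.sortedUnion J)]
    rw [List.ofFn_congr (I.length_sortedUnion J)]
    rfl
  rw [Fin.univ_val_map, h, KSubset.sortedUnion, Multiset.sort_eq]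

theorem KSubset.card_filter_merged (P : Fin n → Prop) [DecidablePred P] :
    (Finset.univ.filter fun p => P (I.merged J p)).card =
      (I.1.filter P).card + (J.1.filter P).card := by
  have h := congrArg (Multiset.countP P) (I.map_merged J)
  rw [Multiset.countP_map, Multiset.countP_add, Multiset.countP_eq_card_filter,
    Multiset.countP_eq_card_filter] at h
  exact h

/-- The copies of x fill a block of consecutive positions, which starts after all smaller elements
and is as long as the multiplicity of x. -/
theorem KSubset.merged_eq_iff (p : Fin (2 * k)) (x : Fin n) : I.merged J p = x ↔
    countBelow I.1 x + countBelow J.1 x ≤ p.1 ∧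
      p.1 < countBelow I.1 x + countBelow J.1 x +
        ((if x ∈ I.1 then 1 else 0) + if x ∈ J.1 then 1 else 0) := by
  have h1 := Tuple.lt_card_lt_iff_apply_lt_of_monotone (I.merged_mono J) (j := p) (a := x)
  have h2 := Tuple.lt_card_le_iff_apply_le_of_monotone (I.merged_mono J) (j := p) (a := x)
  rw [I.card_filter_merged J (· < x)] at h1
  rw [I.card_filter_merged J (· ≤ x)] at h2
  have h3 : ∀ A : Finset (Fin n), (A.filter (· ≤ x)).card =
      countBelow A x + if x ∈ A then 1 else 0 := by
    intro A
    have : A.filter (· ≤ x) = A.filter (· < x) ∪ A.filter (· = x) := by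
      ext z; simp only [Finset.mem_filter, Finset.mem_union, le_iff_lt_or_eq]; tauto
    rw [this, Finset.card_union_of_disjoint, Finset.filter_eq', countBelow]
    · split_ifs <;> simp
    · rw [Finset.disjoint_left]; intro z; simp only [Finset.mem_filter]
      exact fun h1 h2 => h1.2.ne h2.2
  rw [h3, h3] at h2
  rw [le_antisymm_iff, ← h2, ← not_lt (b := x), ← h1]
  simp only [countBelow]
  omega

theorem KSubset.merged_lt_length (x : Fin n) : countBelow I.1 x + countBelow J.1 x +
    ((if x ∈ I.1 then 1 else 0) + if x ∈ J.1 then 1 else 0) ≤ 2 * k := by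
  by_contra hcon
  have hI : ∀ A : KSubset k n, countBelow A.1 x + (if x ∈ A.1 then 1 else 0) ≤ k := by
    intro A
    have : countBelow A.1 x + (if x ∈ A.1 then 1 else 0) = (A.1.filter (· ≤ x)).card := by
      have : A.1.filter (· ≤ x) = A.1.filter (· < x) ∪ A.1.filter (· = x) := by
        ext z; simp only [Finset.mem_filter, Finset.mem_union, le_iff_lt_or_eq]; tauto
      rw [this, Finset.card_union_of_disjoint, Finset.filter_eq', countBelow]
      · split_ifs <;> simp
      · rw [Finset.disjoint_left]; intro z; simp only [Finset.mem_filter]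
        exact fun h1 h2 => h1.2.ne h2.2
    rw [this]
    exact (Finset.card_filter_le _ _).trans A.2.le
  have := hI I
  have := hI J
  omega

/-- A common element fills two consecutive positions, one of each parity; any other element of the
union has a single position, whose parity decides. -/
theorem KSubset.mem_sortOne {x : Fin n} : x ∈ (I.sortOne J).1 ↔
    (x ∈ I.1 ∧ x ∈ J.1) ∨
      (¬ (x ∈ I.1 ↔ x ∈ J.1) ∧ Even (countBelow I.1 x + countBelow J.1 x)) := by
  simp only [KSubset.sortOne, KSubset.ofInjective, Finset.mem_image, Finset.mem_univ, true_and,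
    KSubset.merged_eq_iff]
  have h := I.merged_lt_length J x
  generalize countBelow I.1 x + countBelow J.1 x = c at *
  constructor
  · rintro ⟨r, h1, h2⟩
    by_cases hI : x ∈ I.1 <;> by_cases hJ : x ∈ J.1 <;> simp [hI, hJ] at * <;>
      first | omega | exact ⟨r, by omega⟩
  · intro h'
    have hk : (if x ∈ I.1 then 1 else 0) + (if x ∈ J.1 then 1 else 0) = 2 ∨
      ((if x ∈ I.1 then 1 else 0) + (if x ∈ J.1 then 1 else 0) = 1 ∧ Even c) := by
      by_cases hI : x ∈ I.1 <;> by_cases hJ : x ∈ J.1 <;> simp [hI, hJ] at * <;> assumption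
    -- Rounding up makes 2r the first even position not before the block.
    refine ⟨⟨(c + 1) / 2, ?_⟩, ?_, ?_⟩
    · rcases hk with hk | ⟨hk, m, rfl⟩ <;> omega
    · simp only; omega
    · simp only
      rcases hk with hk | ⟨hk, m, rfl⟩ <;> omega

theorem KSubset.mem_sortTwo {x : Fin n} : x ∈ (I.sortTwo J).1 ↔
    (x ∈ I.1 ∧ x ∈ J.1) ∨
      (¬ (x ∈ I.1 ↔ x ∈ J.1) ∧ ¬ Even (countBelow I.1 x + countBelow J.1 x)) := by
  simp only [KSubset.sortTwo, KSubset.ofInjective, Finset.mem_image, Finset.mem_univ, true_and,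
    KSubset.merged_eq_iff]
  have h := I.merged_lt_length J x
  generalize countBelow I.1 x + countBelow J.1 x = c at *
  rw [Nat.even_iff]
  constructor
  · rintro ⟨r, h1, h2⟩
    by_cases hI : x ∈ I.1 <;> by_cases hJ : x ∈ J.1 <;> simp [hI, hJ] at * <;> omega
  · intro h'
    have hk : (if x ∈ I.1 then 1 else 0) + (if x ∈ J.1 then 1 else 0) = 2 ∨
      ((if x ∈ I.1 then 1 else 0) + (if x ∈ J.1 then 1 else 0) = 1 ∧ c % 2 = 1) := by
      by_cases hI : x ∈ I.1 <;> by_cases hJ : x ∈ J.1 <;> simp [hI, hJ] at * <;> assumption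
    refine ⟨⟨c / 2, ?_⟩, ?_, ?_⟩
    · rcases hk with hk | ⟨hk, hc⟩ <;> omega
    · simp only; omega
    · simp only; omega

theorem countBelow_eq_sdiff_add_inter {α : Type*} [LinearOrder α] (I J : Finset α) (x : α) :
    countBelow I x = countBelow (I \ J) x + countBelow (I ∩ J) x := by
  rw [countBelow, countBelow, countBelow, ← Finset.card_union_of_disjoint, ← Finset.filter_union,
    Finset.sdiff_union_inter]
  rw [Finset.disjoint_left]; intro z; simp only [Finset.mem_filter, Finset.mem_sdiff, Finset.mem_inter]
  tauto

theorem Compatible.sortOne_sortTwo {σ : Fin n → Fin n} {S : Finset (Fin n)} {I J : KSubset k n}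
    (h : Compatible σ S I.1 J.1) (hσ : IsNoncrossingMatching σ) :
    Compatible σ S (I.sortOne J).1 (I.sortTwo J).1 := by
  refine h.of_arcs hσ (fun x => ?_) ?_
  · rw [KSubset.mem_sortOne, KSubset.mem_sortTwo]
    tauto
  · intro p m _ h1 h2 h3 h4 h5
    rw [KSubset.mem_sortOne, KSubset.mem_sortOne]
    -- Common elements are counted twice and do not affect parity.
    have e : ∀ x, Even (countBelow I.1 x + countBelow J.1 x) ↔
        Even (countBelow (I.1 \ J.1) x + countBelow (J.1 \ I.1) x) := by
      intro x
      rw [countBelow_eq_sdiff_add_inter I.1 J.1, countBelow_eq_sdiff_add_inter J.1 I.1,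
        Finset.inter_comm J.1 I.1, Nat.even_iff, Nat.even_iff]
      omega
    rw [e, e, h1, h2]
    simp only [Finset.mem_sdiff, Nat.even_iff] at *
    grind

theorem KSubset.merged_minSet_maxSet : (I.minSet J).merged (I.maxSet J) = I.merged J := by
  have h : (I.minSet J).1.val + (I.maxSet J).1.val = I.1.val + J.1.val := by
    ext x
    rw [Multiset.count_add, Multiset.count_add]
    have hc : ∀ A : Finset (Fin n), A.val.count x = if x ∈ A then 1 else 0 := fun A =>
      Multiset.count_eq_of_nodup A.nodup
    rw [hc, hc, hc, hc]
    have h1 := I.mem_minSet J (x := x)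
    have h2 := I.mem_maxSet J (x := x)
    simp only [Finset.mem_sdiff] at h1 h2
    have := le_or_gt (countBelow (J.1 \ I.1) x) (countBelow (I.1 \ J.1) x)
    have := le_or_gt (countBelow (I.1 \ J.1) x) (countBelow (J.1 \ I.1) x)
    by_cases hI : x ∈ I.1 <;> by_cases hJ : x ∈ J.1 <;> simp only [hI, hJ] at h1 h2 ⊢ <;>
      by_cases hm : x ∈ (I.minSet J).1 <;> by_cases hM : x ∈ (I.maxSet J).1 <;>
      simp only [hm, hM] at h1 h2 ⊢ <;> simp at * <;> omega
  have h' : (I.minSet J).sortedUnion (I.maxSet J) = I.sortedUnion J := by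
    rw [KSubset.sortedUnion, h]; rfl
  funext p
  simp only [KSubset.merged, List.get_eq_getElem, h']
  rfl

theorem KSubset.sortOne_minSet_maxSet : (I.minSet J).sortOne (I.maxSet J) = I.sortOne J := by
  simp only [KSubset.sortOne, KSubset.merged_minSet_maxSet]

theorem KSubset.sortTwo_minSet_maxSet : (I.minSet J).sortTwo (I.maxSet J) = I.sortTwo J := by
  simp only [KSubset.sortTwo, KSubset.merged_minSet_maxSet]

/-- A function in the cone generated by the noncrossing matchings grows along replacements of
pairs that preserve compatibility. -/
theorem MatchingCone.le_of_compatible {α : Type*} [LinearOrder α] {Z : Set α}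
    {f : Finset α → Finset α → ℝ} (hf : MatchingCone Z f) {I J I' J' : Finset α}
    (h : ∀ σ S, IsNoncrossingMatching σ → Compatible σ S I J → Compatible σ S I' J') :
    f I J ≤ f I' J' := by
  induction hf with
  | ind σ S hσ _ =>
    unfold compatInd
    by_cases h1 : Compatible σ S I J
    · rw [if_pos h1, if_pos (h σ S hσ h1)]
    · rw [if_neg h1]; split_ifs <;> norm_num
  | add f g _ _ hf hg => exact add_le_add hf hg
  | smul c f hc _ hf => exact mul_le_mul_of_nonneg_left hf hc

end KSubset

/-! ### Maximal minors, hyperplane functionals and the exchange argument -/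

section Minors

variable {m n : ℕ}

/-- The maximal minor of a configuration of `n` vectors in `ℝᵐ⁺¹` on the index set `I`; it is `0`
if `I` does not have `m + 1` elements. -/
noncomputable def minor (w : Fin n → Fin (m + 1) → ℝ) (I : Finset (Fin n)) : ℝ :=
  if h : I.card = m + 1 then volumeForm (m + 1) (w ∘ I.orderEmbOfFin h) else 0

/-- The linear functional `v ↦ det (v, w c₁, …, w cₘ)`, where `C = {c₁ < ⋯ < cₘ}`. -/
noncomputable def coMinor (w : Fin n → Fin (m + 1) → ℝ) (C : Finset (Fin n)) :
    (Fin (m + 1) → ℝ) →ₗ[ℝ] ℝ :=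
  if h : C.card = m then
    (volumeForm (m + 1)).toMultilinearMap.toLinearMap
      (Fin.cons 0 (w ∘ C.orderEmbOfFin h) : Fin (m + 1) → Fin (m + 1) → ℝ) 0
  else 0

variable {w : Fin n → Fin (m + 1) → ℝ}

theorem coMinor_apply {C : Finset (Fin n)} (h : C.card = m) (v : Fin (m + 1) → ℝ) :
    coMinor w C v = volumeForm (m + 1)
      (Fin.cons v (w ∘ C.orderEmbOfFin h) : Fin (m + 1) → Fin (m + 1) → ℝ) := by
  rw [coMinor, dif_pos h, MultilinearMap.toLinearMap_apply, Fin.update_cons_zero]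
  rfl

theorem coMinor_of_card_ne {C : Finset (Fin n)} (h : C.card ≠ m) : coMinor w C = 0 := by
  rw [coMinor, dif_neg h]

theorem coMinor_congr {w' : Fin n → Fin (m + 1) → ℝ} {C : Finset (Fin n)}
    (h : ∀ c ∈ C, w c = w' c) : coMinor w C = coMinor w' C := by
  by_cases hC : C.card = m
  · have : w ∘ C.orderEmbOfFin hC = w' ∘ C.orderEmbOfFin hC := by
      funext r; exact h _ (Finset.orderEmbOfFin_mem _ _ _)
    ext1 v
    rw [coMinor, coMinor, dif_pos hC, dif_pos hC, this]
  · rw [coMinor_of_card_ne hC, coMinor_of_card_ne hC]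

theorem coMinor_apply_mem {C : Finset (Fin n)} {x : Fin n} (hx : x ∈ C) :
    coMinor w C (w x) = 0 := by
  by_cases hC : C.card = m
  · rw [coMinor_apply hC]
    obtain ⟨r, hr⟩ : ∃ r, C.orderEmbOfFin hC r = x := by
      have : x ∈ Set.range (C.orderEmbOfFin hC) := by rw [Finset.range_orderEmbOfFin]; exact hx
      exact this
    refine AlternatingMap.map_eq_zero_of_eq _ _ (i := 0) (j := r.succ) ?_ (Fin.succ_ne_zero r).symm
    simp [hr]
  · rw [coMinor_of_card_ne hC]; rfl

theorem minor_congr {w' : Fin n → Fin (m + 1) → ℝ} {I : Finset (Fin n)}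
    (h : ∀ c ∈ I, w c = w' c) : minor w I = minor w' I := by
  by_cases hC : I.card = m + 1
  · have : w ∘ I.orderEmbOfFin hC = w' ∘ I.orderEmbOfFin hC := by
      funext r; exact h _ (Finset.orderEmbOfFin_mem _ _ _)
    rw [minor, minor, dif_pos hC, dif_pos hC, this]
  · rw [minor, minor, dif_neg hC, dif_neg hC]

theorem card_of_minor_ne_zero {I : Finset (Fin n)} (h : minor w I ≠ 0) : I.card = m + 1 := by
  by_contra hI; exact h (by rw [minor, dif_neg hI])

/-- Moving the vector of x from the first row to its sorted place is a cycle past the elements of C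
below x. -/
theorem minor_insert {C : Finset (Fin n)} {x : Fin n} (hx : x ∉ C) :
    minor w (insert x C) = (-1) ^ countBelow C x * coMinor w C (w x) := by
  have hcard := Finset.card_insert_of_notMem hx
  by_cases hC : C.card = m
  · have hI : (insert x C).card = m + 1 := by omega
    have hp : countBelow C x < m + 1 := by
      have : countBelow C x ≤ C.card := Finset.card_filter_le _ _
      omega
    let p : Fin (m + 1) := ⟨countBelow C x, hp⟩
    have hlt : ∀ r : Fin m, r.1 < countBelow C x ↔ C.orderEmbOfFin hC r < x :=
      fun r => KSubset.lt_countBelow_iff ⟨C, hC⟩ x r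
    have hmem : ∀ r, C.orderEmbOfFin hC r ∈ C := fun r => Finset.orderEmbOfFin_mem _ _ _
    have hmono : StrictMono (p.insertNth x (C.orderEmbOfFin hC) : Fin (m + 1) → Fin n) := by
      rw [Fin.strictMono_insertNth_iff]
      refine ⟨(C.orderEmbOfFin hC).strictMono, fun r h => ?_, fun r h => ?_⟩
      · rw [← hlt]
        exact Fin.lt_def.1 h
      · refine lt_of_le_of_ne (not_lt.1 fun h' => ?_) fun h' => hx (h' ▸ hmem _)
        rw [← hlt] at h'
        exact absurd (Fin.le_def.1 h) (not_le.2 h')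
    have hf : (p.insertNth x (C.orderEmbOfFin hC) : Fin (m + 1) → Fin n) =
        (insert x C).orderEmbOfFin hI := by
      refine Finset.orderEmbOfFin_unique hI (fun r => ?_) hmono
      refine Fin.succAboveCases p ?_ (fun r => ?_) r
      · simp
      · simp [hmem]
    have hw : w ∘ (p.insertNth x (C.orderEmbOfFin hC) : Fin (m + 1) → Fin n) =
        (Fin.cons (w x) (w ∘ C.orderEmbOfFin hC) : Fin (m + 1) → Fin (m + 1) → ℝ) ∘
          p.cycleRange := by
      rw [Fin.cons_comp_cycleRange]
      funext r
      refine Fin.succAboveCases p ?_ (fun r => ?_) r <;> simp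
    rw [minor, dif_pos hI, ← hf, hw, AlternatingMap.map_perm, coMinor_apply hC, Fin.sign_cycleRange,
      Units.smul_def, zsmul_eq_mul]
    simp [p]
  · rw [minor, dif_neg (by omega), coMinor_of_card_ne hC]; simp

theorem minor_insert_ne_zero_iff {C : Finset (Fin n)} {x : Fin n} (hx : x ∉ C) :
    minor w (insert x C) ≠ 0 ↔ coMinor w C (w x) ≠ 0 := by
  rw [minor_insert hx, mul_ne_zero_iff, and_iff_right (pow_ne_zero _ (by norm_num))]

theorem coMinor_erase_ne_zero {I : Finset (Fin n)} (hI : minor w I ≠ 0) {x : Fin n} (hx : x ∈ I) :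
    coMinor w (I.erase x) (w x) ≠ 0 := by
  rw [← minor_insert_ne_zero_iff (Finset.notMem_erase x I), Finset.insert_erase hx]
  exact hI

theorem exists_eq_sum_of_minor_ne_zero {I : Finset (Fin n)} (hI : minor w I ≠ 0)
    (v : Fin (m + 1) → ℝ) : ∃ a : Fin n → ℝ, v = ∑ y ∈ I, a y • w y := by
  have hc := card_of_minor_ne_zero hI
  rw [minor, dif_pos hc] at hI
  have h1 : IsUnit ((Pi.basisFun ℝ (Fin (m + 1))).det (w ∘ I.orderEmbOfFin hc)) := by
    rw [Pi.basisFun_det_apply]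
    exact isUnit_iff_ne_zero.2 hI
  have h2 := ((Pi.basisFun ℝ (Fin (m + 1))).is_basis_iff_det.2 h1).2
  have h3 : v ∈ Submodule.span ℝ (Set.range (w ∘ I.orderEmbOfFin hc)) := h2 ▸ Submodule.mem_top
  rw [Set.range_comp, Finset.range_orderEmbOfFin,
    Submodule.mem_span_image_finset_iff_exists_fun'] at h3
  exact h3.imp fun _ h => h.symm

theorem map_sum_eq_single (f : (Fin (m + 1) → ℝ) →ₗ[ℝ] ℝ) {I : Finset (Fin n)} {a : Fin n → ℝ}
    {x : Fin n} (hx : x ∈ I) (h : ∀ y ∈ I.erase x, f (w y) = 0) :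
    f (∑ y ∈ I, a y • w y) = a x * f (w x) := by
  rw [map_sum, Finset.sum_eq_single_of_mem x hx, map_smul, smul_eq_mul]
  intro y hy hyx
  rw [map_smul, h y (Finset.mem_erase.2 ⟨hyx, hy⟩), smul_zero]

theorem minor_exchange_ne_zero {I : Finset (Fin n)} (hI : minor w I ≠ 0) {x y : Fin n} (hy : y ∈ I)
    (hx : x ∉ I) {a : Fin n → ℝ} (ha : w x = ∑ z ∈ I, a z • w z) (hay : a y ≠ 0) :
    minor w (insert x (I.erase y)) ≠ 0 := by
  rw [minor_insert_ne_zero_iff (fun h => hx (Finset.mem_of_mem_erase h)), ha,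
    map_sum_eq_single _ hy fun z hz => coMinor_apply_mem hz]
  exact mul_ne_zero hay (coMinor_erase_ne_zero hI hy)

/-- Suppose C ∪ {j} is not a basis, and let H be the functional of the hyperplane spanned by C.
Trading some c < i in C for j gives a C' spanning the same hyperplane, but with one element fewer
below i and equally many below each u > j. Positivity at i makes the functionals of C and C'
negative multiples of each other, and positivity at u then forces H to vanish there. So H vanishes
on U, hence on the i-th vector, which lies in the span of U; but C ∪ {i} is a basis. -/
theorem minor_ne_zero_of_minor_ne_zero_exchange (hw : ∀ I, 0 ≤ minor w I)
    {i j : Fin n} (hij : i < j) {K U : Finset (Fin n)} (hK : ∀ I, minor w I ≠ 0 → K ⊆ I)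
    (hiK : i ∉ K) (hjU : j ∈ U) (hUj : ∀ u ∈ U, u ∈ K ∨ j ≤ u)
    (hU : ∃ I, minor w I ≠ 0 ∧ U ⊆ I) (hiU : ∀ I, minor w I ≠ 0 → ¬ insert i U ⊆ I)
    (hle : ∀ I, minor w I ≠ 0 → ∀ x ∈ I, x ∈ U ∨ x ≤ i)
    {C : Finset (Fin n)} (hiC : i ∉ C) (hjC : j ∉ C) (hC : minor w (insert i C) ≠ 0) :
    minor w (insert j C) ≠ 0 := by
  intro hCj
  have hne := hij.ne
  have hHi : coMinor w C (w i) ≠ 0 := (minor_insert_ne_zero_iff hiC).1 hC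
  have hHj : coMinor w C (w j) = 0 := by
    by_contra h; exact (minor_insert_ne_zero_iff hjC).2 h hCj
  obtain ⟨I', hI', hUI⟩ := hU
  obtain ⟨a, ha⟩ := exists_eq_sum_of_minor_ne_zero hC (w j)
  have hai : a i = 0 := by
    rw [ha, map_sum_eq_single _ (Finset.mem_insert_self i C) fun y hy => coMinor_apply_mem ?_] at hHj
    · exact (mul_eq_zero.1 hHj).resolve_right hHi
    · grind
  have haC : w j = ∑ y ∈ C, a y • w y := by
    rw [Finset.sum_insert hiC, hai, zero_smul, zero_add] at ha
    exact ha
  -- Otherwise the j-th vector would lie in the span of the rest of U, although U is part of a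
  -- basis.
  obtain ⟨c, hcC, hcU, hac⟩ : ∃ c ∈ C, c ∉ U ∧ a c ≠ 0 := by
    by_contra! hcon
    apply coMinor_erase_ne_zero hI' (hUI hjU)
    rw [haC, map_sum]
    refine Finset.sum_eq_zero fun y hy => ?_
    rw [map_smul, smul_eq_mul]
    by_cases hyU : y ∈ U
    · rw [coMinor_apply_mem, mul_zero]
      exact Finset.mem_erase.2 ⟨fun h => hjC (h ▸ hy), hUI hyU⟩
    · rw [hcon y hy hyU, zero_mul]
  have hci : c < i := by
    rcases hle _ hC c (Finset.mem_insert_of_mem hcC) with h | h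
    · exact absurd h hcU
    · exact lt_of_le_of_ne h fun h => hiC (h ▸ hcC)
  set C' := insert j (C.erase c) with hC'
  have hiC' : i ∉ C' := by grind
  have hCi' : minor w (insert i C') ≠ 0 := by
    have h := minor_exchange_ne_zero hC (Finset.mem_insert_of_mem hcC) (x := j) (by grind) ha hac
    have e : insert j ((insert i C).erase c) = insert i C' := by grind
    rwa [e] at h
  have hHi' : coMinor w C' (w i) ≠ 0 := (minor_insert_ne_zero_iff hiC').1 hCi'
  have hHc' : coMinor w C' (w c) = 0 := by
    have h : coMinor w C' (w j) = 0 := coMinor_apply_mem (Finset.mem_insert_self _ _)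
    rw [haC, map_sum_eq_single _ hcC] at h
    · exact (mul_eq_zero.1 h).resolve_left hac
    · exact fun y hy => coMinor_apply_mem (Finset.mem_insert_of_mem hy)
  -- Both functionals vanish on C, so they are proportional; their values at the i-th vector fix the
  -- ratio.
  have hprop : ∀ v, coMinor w C' v * coMinor w C (w i) = coMinor w C v * coMinor w C' (w i) := by
    intro v
    obtain ⟨b, rfl⟩ := exists_eq_sum_of_minor_ne_zero hC v
    have hsub : ∀ y ∈ (insert i C).erase i, y ∈ C := by grind
    rw [map_sum_eq_single _ (Finset.mem_insert_self i C) fun y hy => coMinor_apply_mem (hsub y hy),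
      map_sum_eq_single _ (Finset.mem_insert_self i C) fun y hy => ?_]
    · ring
    · by_cases hyc : y = c
      · rw [hyc, hHc']
      · exact coMinor_apply_mem (Finset.mem_insert_of_mem (Finset.mem_erase.2 ⟨hyc, hsub y hy⟩))
  have hCb : ∀ x, c < x → countBelow C x = countBelow (C.erase c) x + 1 := by
    intro x hx
    rw [countBelow, countBelow, Finset.filter_erase, Finset.card_erase_add_one]
    exact Finset.mem_filter.2 ⟨hcC, hx⟩
  have hjc : j ∉ C.erase c := fun h => hjC (Finset.mem_of_mem_erase h)
  have hbi : countBelow C i = countBelow C' i + 1 := by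
    rw [hCb i hci, hC', countBelow, countBelow, Finset.filter_insert, if_neg (not_lt.2 hij.le)]
  have hbu : ∀ u, j < u → countBelow C' u = countBelow C u := by
    intro u hu
    rw [hCb u (hci.trans (hij.trans hu)), hC', countBelow, countBelow, Finset.filter_insert,
      if_pos hu, Finset.card_insert_of_notMem (by simp [hjc])]
  have hU0 : ∀ u ∈ U, coMinor w C (w u) = 0 := by
    intro u hu
    by_cases huC : u ∈ C
    · exact coMinor_apply_mem huC
    rcases hUj u hu with huK | hju
    · have := hK _ hC huK
      grind
    rcases hju.eq_or_lt with rfl | hju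
    · exact hHj
    have huC' : u ∉ C' := by grind
    have p1 := hw (insert u C)
    have p2 := hw (insert u C')
    have p3 := lt_of_le_of_ne (hw _) (Ne.symm hC)
    have p4 := lt_of_le_of_ne (hw _) (Ne.symm hCi')
    rw [minor_insert huC] at p1
    rw [minor_insert huC', hbu u hju] at p2
    rw [minor_insert hiC, hbi, pow_succ] at p3
    rw [minor_insert hiC'] at p4
    have h := hprop (w u)
    generalize coMinor w C (w u) = x at *
    generalize coMinor w C' (w u) = x' at *
    generalize coMinor w C (w i) = y at *
    generalize coMinor w C' (w i) = y' at *
    rcases neg_one_pow_eq_or ℝ (countBelow C u) with e1 | e1 <;>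
      rcases neg_one_pow_eq_or ℝ (countBelow C' i) with e2 | e2 <;>
      rw [e1] at p1 p2 <;> rw [e2] at p3 p4 <;> clear e1 e2 <;> by_contra hx <;>
      rcases lt_or_gt_of_ne hx with hx | hx <;> nlinarith
  have hiI' : i ∉ I' := fun h => hiU I' hI' (Finset.insert_subset h hUI)
  -- A nonzero coefficient at some y outside U would make I' with y replaced by i a basis containing
  -- U and i.
  obtain ⟨b, hb⟩ := exists_eq_sum_of_minor_ne_zero hI' (w i)
  apply hHi
  rw [hb, map_sum]
  refine Finset.sum_eq_zero fun y hy => ?_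
  rw [map_smul, smul_eq_mul]
  by_cases hyU : y ∈ U
  · rw [hU0 y hyU, mul_zero]
  · by_cases hby : b y = 0
    · rw [hby, zero_mul]
    · refine absurd ?_ (hiU _ (minor_exchange_ne_zero hI' hy hiI' hb hby))
      exact Finset.insert_subset_insert _ fun u hu => Finset.mem_erase.2 ⟨fun h => hyU (h ▸ hu), hUI hu⟩

end Minors

/-! ### Reducing a totally nonnegative configuration -/

section Reduction

variable {m n : ℕ} {w : Fin n → Fin (m + 1) → ℝ}

theorem exists_minor_ne_zero_of_mem_of_not_mem {i j : Fin n} (hij : i ≠ j)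
    (hi : ∃ I, minor w I ≠ 0 ∧ i ∈ I) (hj : ∃ I, minor w I ≠ 0 ∧ j ∉ I) :
    ∃ I, minor w I ≠ 0 ∧ i ∈ I ∧ j ∉ I := by
  obtain ⟨I, hI, hiI⟩ := hi
  obtain ⟨B, hB, hjB⟩ := hj
  by_cases hiB : i ∈ B
  · exact ⟨B, hB, hiB, hjB⟩
  obtain ⟨b, hb⟩ := exists_eq_sum_of_minor_ne_zero hB (w i)
  obtain ⟨y, hy, hby⟩ : ∃ y ∈ B, b y ≠ 0 := by
    by_contra! hcon
    have h0 : w i = 0 := by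
      rw [hb]
      exact Finset.sum_eq_zero fun y hy => by rw [hcon y hy, zero_smul]
    exact coMinor_erase_ne_zero hI hiI (by rw [h0, map_zero])
  refine ⟨_, minor_exchange_ne_zero hB hy hiB hb hby, Finset.mem_insert_self _ _, ?_⟩
  grind

/-- Replacing row j by row i costs a sign for each basis element strictly between them. By `hK`
these elements are the same for all bases, so one sign in the coefficient corrects every minor. -/
theorem minor_update_sub_smul {i j : Fin n} (hij : i < j) (t : ℝ) {K : Finset (Fin n)}
    (hK : ∀ I, minor w I ≠ 0 → ∀ z, i < z → z < j → (z ∈ I ↔ z ∈ K)) (I : Finset (Fin n)) :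
    minor (Function.update w j
      (w j - ((-1) ^ (K.filter fun z => i < z ∧ z < j).card * t) • w i)) I =
      minor w I - t * (if j ∈ I ∧ i ∉ I then minor w (exchange i j I) else 0) := by
  set w' := Function.update w j
      (w j - ((-1) ^ (K.filter fun z => i < z ∧ z < j).card * t) • w i) with hw'
  have hne : ∀ x, x ≠ j → w' x = w x := fun x hx => Function.update_of_ne hx _ _
  by_cases hj : j ∈ I
  · have hC : coMinor w' (I.erase j) = coMinor w (I.erase j) :=
      coMinor_congr fun c hc => hne c (Finset.ne_of_mem_erase hc)
    have hjC := Finset.notMem_erase j I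
    rw [← Finset.insert_erase hj, minor_insert hjC, minor_insert hjC, hC, hw', Function.update_self,
      map_sub, map_smul, smul_eq_mul, Finset.insert_erase hj, mul_sub]
    congr 1
    by_cases hi : i ∈ I
    · rw [coMinor_apply_mem (Finset.mem_erase.2 ⟨hij.ne, hi⟩), if_neg (by tauto)]
      ring
    · rw [if_pos ⟨hj, hi⟩]
      have hiC : i ∉ I.erase j := fun h => hi (Finset.mem_of_mem_erase h)
      rw [exchange, minor_insert hiC]
      by_cases h0 : coMinor w (I.erase j) (w i) = 0
      · rw [h0]; ring
      have hb := (minor_insert_ne_zero_iff hiC).2 h0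
      have hf : ((I.erase j).filter fun z => i < z ∧ z < j) = K.filter fun z => i < z ∧ z < j := by
        ext z
        simp only [Finset.mem_filter]
        refine and_congr_left fun h => ?_
        rw [← hK _ hb z h.1 h.2, Finset.mem_insert, or_iff_right h.1.ne']
      rw [countBelow_eq_add hij, hf, if_neg hiC, add_zero, pow_add]
      have hs : ∀ c : ℕ, ((-1 : ℝ) ^ c) * (-1) ^ c = 1 := fun c => by
        rw [← mul_pow]; norm_num
      linear_combination (-1) ^ countBelow (I.erase j) i * t * coMinor w (I.erase j) (w i) *
        hs (K.filter fun z => i < z ∧ z < j).card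
  · rw [if_neg (by tauto), mul_zero, sub_zero]
    exact minor_congr fun c hc => hne c fun h => hj (h ▸ hc)

/-- `z` is contained in all bases of the configuration `w`, or in none. -/
def IsLoopOrColoop (w : Fin n → Fin (m + 1) → ℝ) (z : Fin n) : Prop :=
  (∀ I, minor w I ≠ 0 → z ∈ I) ∨ (∀ I, minor w I ≠ 0 → z ∉ I)

theorem matchingCone_of_forall_isLoopOrColoop (h0 : ∃ I, minor w I ≠ 0)
    (h : ∀ z, IsLoopOrColoop w z) (Z : Set (Fin n)) :
    MatchingCone Z (fun I J => minor w I * minor w J) := by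
  obtain ⟨B, hB⟩ := h0
  have huniq : ∀ I, minor w I ≠ 0 → I = B := by
    intro I hI
    ext z
    rcases h z with hz | hz
    · exact iff_of_true (hz I hI) (hz B hB)
    · exact iff_of_false (hz I hI) (hz B hB)
  have hid : IsNoncrossingMatching (id : Fin n → Fin n) :=
    ⟨fun _ => rfl, fun x y h1 h2 => absurd h1 (lt_asymm h2)⟩
  convert (MatchingCone.ind (Z := Z) id B hid fun _ _ => rfl).smul (minor w B * minor w B) _
    (mul_self_nonneg _) using 1
  funext I J
  have hc : Compatible id B I J ↔ I = B ∧ J = B := by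
    simp only [Compatible, id]
    constructor
    · exact fun h => ⟨Finset.ext fun x => ((h x).2.1 trivial),
        Finset.ext fun x => (h x).1.symm.trans ((h x).2.1 trivial)⟩
    · rintro ⟨rfl, rfl⟩ x
      simp
  unfold compatInd
  by_cases hI : I = B
  · by_cases hJ : J = B
    · rw [if_pos (hc.2 ⟨hI, hJ⟩), hI, hJ, mul_one]
    · rw [if_neg fun h => hJ (hc.1 h).2, mul_zero, (not_imp_comm.1 (huniq J)) hJ, mul_zero]
  · rw [if_neg fun h => hI (hc.1 h).1, mul_zero, (not_imp_comm.1 (huniq I)) hI, zero_mul]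

/-- For a totally nonnegative configuration not all of whose elements are loops or coloops, there
are consecutive elements `i < j` among those that are neither such that exchanging `i` for `j`
in a basis always gives a basis. -/
theorem exists_exchangeable (hw : ∀ I, 0 ≤ minor w I) (h : ∃ z, ¬ IsLoopOrColoop w z) :
    ∃ i j, i < j ∧ ¬ IsLoopOrColoop w i ∧ ¬ IsLoopOrColoop w j ∧
      (∀ z, i < z → z < j → IsLoopOrColoop w z) ∧
      ∀ C, i ∉ C → j ∉ C → minor w (insert i C) ≠ 0 → minor w (insert j C) ≠ 0 := by
  classical
  let K : Finset (Fin n) := Finset.univ.filter fun z => ∀ I, minor w I ≠ 0 → z ∈ I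
  let A : Finset (Fin n) := Finset.univ.filter fun z => ¬ IsLoopOrColoop w z
  have hKA : ∀ z ∈ A, z ∉ K := by
    intro z hz hzK
    exact (Finset.mem_filter.1 hz).2 (.inl (Finset.mem_filter.1 hzK).2)
  have hcover : ∀ I, minor w I ≠ 0 → ∀ z ∈ I, z ∈ K ∨ z ∈ A := by
    intro I hI z hz
    by_cases hzA : z ∈ A
    · exact .inr hzA
    · left
      have h1 : IsLoopOrColoop w z := by
        by_contra hcon; exact hzA (Finset.mem_filter.2 ⟨Finset.mem_univ _, hcon⟩)
      rcases h1 with h1 | h1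
      · exact Finset.mem_filter.2 ⟨Finset.mem_univ _, h1⟩
      · exact absurd hz (h1 I hI)
  have hK : ∀ I, minor w I ≠ 0 → K ⊆ I := fun I hI z hz => (Finset.mem_filter.1 hz).2 I hI
  have hloop : ∀ z ∈ A, ∃ I, minor w I ≠ 0 ∧ z ∈ I := by
    intro z hz
    by_contra! hcon
    exact (Finset.mem_filter.1 hz).2 (.inr hcon)
  have hcoloop : ∀ z ∈ A, ∃ I, minor w I ≠ 0 ∧ z ∉ I := by
    intro z hz
    by_contra! hcon
    exact (Finset.mem_filter.1 hz).2 (.inl hcon)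
  have hA : A.Nonempty := h.imp fun z hz => Finset.mem_filter.2 ⟨Finset.mem_univ _, hz⟩
  let U : Fin n → Finset (Fin n) := fun a => K ∪ A.filter (a ≤ ·)
  let ind : Finset (Fin n) → Prop := fun Y => ∃ I, minor w I ≠ 0 ∧ Y ⊆ I
  -- Taking i largest in P and j next in A makes the coloops together with A from j on independent,
  -- and dependent once i is added.
  let P : Finset (Fin n) := A.filter fun a => ¬ ind (U a)
  have hP : P.Nonempty := by
    refine ⟨A.min' hA, Finset.mem_filter.2 ⟨Finset.min'_mem _ _, ?_⟩⟩
    rintro ⟨I, hI, hUI⟩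
    have hAI : ∀ z, z ∈ K ∨ z ∈ A → z ∈ I := by
      intro z hz
      apply hUI
      rw [Finset.mem_union]
      exact hz.imp id fun h => Finset.mem_filter.2 ⟨h, Finset.min'_le _ _ h⟩
    obtain ⟨J, hJ, hzJ⟩ := hcoloop _ (Finset.min'_mem _ hA)
    have hJI : J ⊆ I := fun z hz => hAI z (hcover J hJ z hz)
    have : J = I := Finset.eq_of_subset_of_card_le hJI
      (by rw [card_of_minor_ne_zero hI, card_of_minor_ne_zero hJ])
    exact hzJ (this ▸ hAI _ (.inr (Finset.min'_mem _ hA)))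
  obtain ⟨i, hi⟩ : ∃ i, i = P.max' hP := ⟨_, rfl⟩
  have hiP : i ∈ P := hi ▸ Finset.max'_mem _ _
  have hiA : i ∈ A := (Finset.mem_filter.1 hiP).1
  have hiU : ¬ ind (U i) := (Finset.mem_filter.1 hiP).2
  have hB : (A.filter (i < ·)).Nonempty := by
    by_contra hcon
    rw [Finset.not_nonempty_iff_eq_empty, Finset.filter_eq_empty_iff] at hcon
    obtain ⟨I, hI, hiI⟩ := hloop i hiA
    refine hiU ⟨I, hI, fun z hz => ?_⟩
    rcases Finset.mem_union.1 hz with hz | hz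
    · exact hK I hI hz
    · rw [Finset.mem_filter] at hz
      have : z = i := le_antisymm (not_lt.1 (hcon hz.1)) hz.2
      rwa [this]
  obtain ⟨j, hj⟩ : ∃ j, j = (A.filter (i < ·)).min' hB := ⟨_, rfl⟩
  have hjB : j ∈ A.filter (i < ·) := hj ▸ Finset.min'_mem _ _
  have hjA : j ∈ A := (Finset.mem_filter.1 hjB).1
  have hij : i < j := (Finset.mem_filter.1 hjB).2
  have hjle : ∀ z ∈ A, i < z → j ≤ z := fun z hz hiz =>
    hj ▸ Finset.min'_le _ _ (Finset.mem_filter.2 ⟨hz, hiz⟩)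
  have hjU : ind (U j) := by
    by_contra hcon
    have : j ≤ i := hi ▸ Finset.le_max' P j (Finset.mem_filter.2 ⟨hjA, hcon⟩)
    exact absurd hij (not_lt.2 this)
  refine ⟨i, j, hij, (Finset.mem_filter.1 hiA).2, (Finset.mem_filter.1 hjA).2, ?_, ?_⟩
  · intro z hiz hzj
    by_contra hcon
    exact absurd hzj (not_lt.2 (hjle z (Finset.mem_filter.2 ⟨Finset.mem_univ _, hcon⟩) hiz))
  · intro C hiC hjC hC
    refine minor_ne_zero_of_minor_ne_zero_exchange hw hij (K := K) (U := U j) hK (hKA i hiA) ?_ ?_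
      hjU ?_ ?_ hiC hjC hC
    · exact Finset.mem_union_right _ (Finset.mem_filter.2 ⟨hjA, le_rfl⟩)
    · intro u hu
      exact (Finset.mem_union.1 hu).imp id fun h => (Finset.mem_filter.1 h).2
    · intro I hI hsub
      refine hiU ⟨I, hI, fun z hz => hsub ?_⟩
      rcases Finset.mem_union.1 hz with hz | hz
      · exact Finset.mem_insert_of_mem (Finset.mem_union_left _ hz)
      · rw [Finset.mem_filter] at hz
        rcases hz.2.eq_or_lt with rfl | h
        · exact Finset.mem_insert_self _ _
        · exact Finset.mem_insert_of_mem (Finset.mem_union_right _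
            (Finset.mem_filter.2 ⟨hz.1, hjle z hz.1 h⟩))
    · intro I hI x hx
      rcases hcover I hI x hx with hxK | hxA
      · exact .inl (Finset.mem_union_left _ hxK)
      · rcases le_or_gt x i with h | h
        · exact .inr h
        · exact .inl (Finset.mem_union_right _ (Finset.mem_filter.2 ⟨hxA, hjle x hxA h⟩))

/-- Removing the largest possible multiple of the `i`-th vector from the `j`-th vector, for `i, j`
as in `exists_exchangeable`, gives a totally nonnegative configuration with fewer bases. -/
theorem exists_reduction (hw : ∀ I, 0 ≤ minor w I) {i j : Fin n} (hij : i < j)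
    (hi : ¬ IsLoopOrColoop w i) (hj : ¬ IsLoopOrColoop w j)
    (hbet : ∀ z, i < z → z < j → IsLoopOrColoop w z)
    (hex : ∀ C, i ∉ C → j ∉ C → minor w (insert i C) ≠ 0 → minor w (insert j C) ≠ 0) :
    ∃ (w' : Fin n → Fin (m + 1) → ℝ) (t : ℝ), 0 ≤ t ∧ (∀ I, 0 ≤ minor w' I) ∧
      (∃ I, minor w' I ≠ 0) ∧ (∀ I, minor w' I ≠ 0 → minor w I ≠ 0) ∧
      (∃ I, minor w I ≠ 0 ∧ minor w' I = 0) ∧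
      ∀ I, minor w I = minor w' I +
        t * (if j ∈ I ∧ i ∉ I then minor w' (exchange i j I) else 0) := by
  classical
  let K : Finset (Fin n) := Finset.univ.filter fun z => ∀ I, minor w I ≠ 0 → z ∈ I
  have hKbet : ∀ I, minor w I ≠ 0 → ∀ z, i < z → z < j → (z ∈ I ↔ z ∈ K) := by
    intro I hI z h1 h2
    rcases hbet z h1 h2 with h | h
    · exact iff_of_true (h I hI) (Finset.mem_filter.2 ⟨Finset.mem_univ _, h⟩)
    · exact iff_of_false (h I hI) fun hz => h I hI ((Finset.mem_filter.1 hz).2 I hI)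
  obtain ⟨B, hB, hiB, hjB⟩ : ∃ I, minor w I ≠ 0 ∧ i ∈ I ∧ j ∉ I := by
    refine exists_minor_ne_zero_of_mem_of_not_mem hij.ne ?_ ?_
    · by_contra! hcon; exact hi (.inr hcon)
    · by_contra! hcon; exact hj (.inl hcon)
  let T : Finset (Finset (Fin n)) :=
    Finset.univ.filter fun I => (j ∈ I ∧ i ∉ I) ∧ minor w (exchange i j I) ≠ 0
  have hmemT : ∀ I, I ∈ T ↔ (j ∈ I ∧ i ∉ I) ∧ minor w (exchange i j I) ≠ 0 := fun I => by
    simp [T]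
  have hT : T.Nonempty := by
    refine ⟨exchange j i B, (hmemT _).2 ⟨by grind [mem_exchange], ?_⟩⟩
    have : exchange i j (exchange j i B) = B := by
      ext z; simp only [mem_exchange]; grind
    rwa [this]
  -- The least ratio is the largest t that keeps all minors nonnegative; the minor at a minimizer
  -- becomes 0. Since `hex` makes this t positive, no new basis appears.
  obtain ⟨I₁, hI₁, hmin⟩ := T.exists_min_image (fun I => minor w I / minor w (exchange i j I)) hT
  set t := minor w I₁ / minor w (exchange i j I₁) with ht
  have hpos : ∀ {I}, minor w I ≠ 0 → 0 < minor w I := fun h => lt_of_le_of_ne (hw _) h.symm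
  obtain ⟨⟨hj₁, hi₁⟩, hex₁⟩ := (hmemT _).1 hI₁
  have hI₁0 : minor w I₁ ≠ 0 := by
    have := hex (I₁.erase j) (fun h => hi₁ (Finset.mem_of_mem_erase h)) (Finset.notMem_erase _ _) hex₁
    rwa [Finset.insert_erase hj₁] at this
  have htpos : 0 < t := div_pos (hpos hI₁0) (hpos hex₁)
  have hform := minor_update_sub_smul hij t hKbet
  set w' := Function.update w j
      (w j - ((-1) ^ (K.filter fun z => i < z ∧ z < j).card * t) • w i) with hw'
  have hle : ∀ I ∈ T, t * minor w (exchange i j I) ≤ minor w I := fun I hI =>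
    (le_div_iff₀ (hpos ((hmemT I).1 hI).2)).1 (hmin I hI)
  have hcase : ∀ I, I ∉ T → minor w' I = minor w I := by
    intro I hI
    rw [hform I]
    split_ifs with h
    · have : minor w (exchange i j I) = 0 := by
        by_contra h'; exact hI ((hmemT I).2 ⟨h, h'⟩)
      rw [this]; ring
    · ring
  have hcase' : ∀ I, I ∈ T → minor w' I = minor w I - t * minor w (exchange i j I) := by
    intro I hI
    rw [hform I, if_pos ((hmemT I).1 hI).1]
  have hjex : ∀ I, minor w' (exchange i j I) = minor w (exchange i j I) := by
    intro I
    refine hcase _ fun h => ?_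
    have := ((hmemT _).1 h).1.1
    have := hij.ne
    grind [mem_exchange]
  refine ⟨w', t, htpos.le, ?_, ⟨exchange i j I₁, ?_⟩, ?_, ⟨I₁, hI₁0, ?_⟩, ?_⟩
  · intro I
    by_cases hI : I ∈ T
    · rw [hcase' I hI]; exact sub_nonneg.2 (hle I hI)
    · rw [hcase I hI]; exact hw I
  · rw [hjex]; exact hex₁
  · intro I hI
    by_cases hIT : I ∈ T
    · exact ((mul_pos htpos (hpos ((hmemT I).1 hIT).2)).trans_le (hle I hIT)).ne'
    · rwa [hcase I hIT] at hI
  · rw [hcase' I₁ hI₁, ht, div_mul_cancel₀ _ hex₁, sub_self]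
  · intro I
    rw [hjex, hform I]; ring

/-- For a totally nonnegative configuration, the products of pairs of maximal minors are a
nonnegative combination of compatibility indicators of noncrossing matchings. -/
theorem matchingCone_minor_mul_minor (hw : ∀ I, 0 ≤ minor w I) (h0 : ∃ I, minor w I ≠ 0) :
    MatchingCone {z | IsLoopOrColoop w z} (fun I J => minor w I * minor w J) := by
  classical
  induction hN : (Finset.univ.filter fun I => minor w I ≠ 0).card using Nat.strong_induction_on
    generalizing w with
  | _ N ih =>
    by_cases h : ∃ z, ¬ IsLoopOrColoop w z
    · obtain ⟨i, j, hij, hi, hj, hbet, hex⟩ := exists_exchangeable hw h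
      obtain ⟨w', t, ht, hw', h0', hsub, ⟨I₁, hI₁, hI₁'⟩, hform⟩ :=
        exists_reduction hw hij hi hj hbet hex
      have hlt : (Finset.univ.filter fun I => minor w' I ≠ 0).card < N := by
        rw [← hN]
        apply Finset.card_lt_card
        rw [Finset.ssubset_iff_of_subset]
        · exact ⟨I₁, by simp [hI₁], by simp [hI₁']⟩
        · intro I hI
          simp only [Finset.mem_filter, Finset.mem_univ, true_and] at hI ⊢
          exact hsub I hI
      -- Bases of w' are bases of w, so loops and coloops of w remain such for w'.
      have hcone := (ih _ hlt hw' h0' rfl).mono (Z' := {z | IsLoopOrColoop w z}) fun z hz =>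
        hz.imp (fun h I hI => h I (hsub I hI)) (fun h I hI => h I (hsub I hI))
      have hpush : MatchingCone {z | IsLoopOrColoop w z} _ :=
        hcone.pushExchange hij hbet hi hj ht
      refine (congrArg (MatchingCone _) (funext₂ fun I J => ?_)).mp hpush
      symm
      rw [hform I, hform J]
      simp only [pushExchange]
      by_cases hI : j ∈ I ∧ i ∉ I <;> by_cases hJ : j ∈ J ∧ i ∉ J <;> simp only [hI, hJ] <;>
        simp <;> ring
    · push Not at h
      exact matchingCone_of_forall_isLoopOrColoop h0 h _

end Reduction

/-! ### From compatibility to the inequalities -/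

theorem le_of_compatible_of_mem_tnnGrassmannianCone {k n : ℕ} {X : KSubset k n → ℝ}
    (hX : X ∈ tnnGrassmannianCone k n) {I J I' J' : KSubset k n}
    (h : ∀ σ S, IsNoncrossingMatching σ → Compatible σ S I.1 J.1 → Compatible σ S I'.1 J'.1) :
    X I * X J ≤ X I' * X J' := by
  obtain ⟨hP, hnn⟩ := hX
  by_cases h0 : ∃ B, X B ≠ 0
  swap
  · push Not at h0
    simp [h0]
  obtain ⟨B, hB⟩ := h0
  rcases k with - | m
  · have : Subsingleton (KSubset 0 n) :=
      ⟨fun A B => Subtype.ext ((Finset.card_eq_zero.1 A.2).trans (Finset.card_eq_zero.1 B.2).symm)⟩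
    rw [Subsingleton.elim I I', Subsingleton.elim J J']
  obtain ⟨w, hw⟩ := exists_vectors_of_mem_grassmannianCone hP B hB
  have hminor : ∀ A : KSubset (m + 1) n, X A = X B * minor w A.1 := by
    intro A
    rw [hw A, minor, dif_pos A.2]; rfl
  have hBpos : 0 < X B := lt_of_le_of_ne (hnn B) hB.symm
  have hwnn : ∀ A, 0 ≤ minor w A := by
    intro A
    by_cases hA : A.card = m + 1
    · have h1 := hnn ⟨A, hA⟩
      rw [hminor] at h1
      exact nonneg_of_mul_nonneg_right h1 hBpos
    · rw [minor, dif_neg hA]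
  have hne : minor w B.1 ≠ 0 := fun h => hB (by rw [hminor B, h, mul_zero])
  have hle := (matchingCone_minor_mul_minor hwnn ⟨_, hne⟩).le_of_compatible h
  have hmul := mul_le_mul_of_nonneg_left hle (mul_self_nonneg (X B))
  rw [hminor I, hminor J, hminor I', hminor J']
  linarith

theorem mainTheorem7 (k n : ℕ) (X : KSubset k n → ℝ) (hX : X ∈ tnnGrassmannianCone k n)
    (I J : KSubset k n) :
    X I * X J ≤ X (I.minSet J) * X (I.maxSet J) ∧
      X (I.minSet J) * X (I.maxSet J) ≤ X (I.sortOne J) * X (I.sortTwo J) := by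
  refine ⟨le_of_compatible_of_mem_tnnGrassmannianCone hX fun σ S hσ h => h.minSet_maxSet hσ, ?_⟩
  -- The sorted pair is now that of (min, max), so the comparison of any pair with its sorted pair
  -- applies.
  rw [← I.sortOne_minSet_maxSet J, ← I.sortTwo_minSet_maxSet J]
  exact le_of_compatible_of_mem_tnnGrassmannianCone hX fun σ S hσ h => h.sortOne_sortTwo hσ
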